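/- **Setting.** Let either $\Omega=\mathbb R^d$ with $\nu$ the Lebesgue measure, or $\Omega\subset\mathbb R^d$ countable with $\nu$ the counting measure on $\Omega$, and let $P$ be a $\sigma$-finite measure on $\Omega$ with $P\ll\nu$. Let $\Omega_P\subseteq\Omega$ be its support (the smallest relatively closed subset of $\Omega$ of full measure) and $\Omega_P^{cc}=\operatorname{cl}\operatorname{conv}\Omega_P$. Put $\psi_P(\theta)=\log\int e^{\langle x,\theta\rangle}\,dP(x)\in(-\infty,+\infty]$, $\Theta_P=\operatorname{dom}\psi_P=\{\theta:\psi_P(\theta)<\infty\}$, $\psi_P^*(y)=\sup_\theta\{\langle y,\theta\rangle-\psi_P(\theta)\}$, and for $\theta\in\Theta_P$ let $P_\theta$ be the probability measure with $dP_\theta=f_{P_\theta}\,dP$, $f_{P_\theta}(y)=e^{\langle y,\theta\rangle-\psi_P(\theta)}$; these form the exponential family $\mathcal F_P$. It is *minimal* if $\operatorname{int}\Theta_P\ne\emptyset$ and $\operatorname{int}\Omega_P^{cc}\neq\emptyset$, and *steep* if $\psi_P$ is essentially smooth: $\operatorname{int}\Theta_P\neq\emptyset$, $\psi_P$ is differentiable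 on $\operatorname{int}\Theta_P$, and $\|\nabla\psi_P(\theta_k)\|\to\infty$ whenever $\theta_k\in\operatorname{int}\Theta_P$ converges to a boundary point of $\Theta_P$. For a function $\phi$ let $D_\phi(u,v)=\phi(u)-\phi(v)-\langle\nabla\phi(v),u-v\rangle$ for $v\in\operatorname{int}\operatorname{dom}\phi$ (with value $+\infty$ for $u\notin\operatorname{dom}\phi$), and let $\mathrm{KL}(Q\|R)=\int\log\frac{dQ}{dR}\,dQ$ if $Q\ll R$, and $+\infty$ otherwise. For $\hat y\in\mathbb R^d$ and closed $S,S^*\subseteq\mathbb R^d$, a *MEM estimator* is an element of $\operatorname{argmin}\{\psi^*_{P_\lambda}(y):y\in S^*\}$, where $\lambda\in\Theta_P$ is such that the mean of $P_\lambda$ exists and equals $\hat y$; an *ML estimator* is an element of $\operatorname{argmax}\{\log f_{P_\theta}(\hat y):\theta\in S\cap\Theta_P\}$. **Theorem (MEM and ML estimator analogy).** Let $\mathcal F_P$ be minimal and steep, and suppose that for every $\theta\in\operatorname{int}\Theta_P$ the support $\Omega_{P_\theta}$ is either uncountable, or countable with closed convex hull. Let $S,S^*\subseteq\mathbb R^d$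 be closed with $S\cap\operatorname{dom}\psi_P\ne\emptyset$ and $S^*\cap\operatorname{dom}\psi_P^*\neq\emptyset$. Let $\hat y\in\operatorname{int}\Omega_P^{cc}$ and $\hat\theta=\nabla\psi_P^*(\hat y)$. Then $\hat y\in\operatorname{int}\operatorname{dom}\psi_P^*$, $\psi_P^*$ is differentiable at $\hat y$, $\hat\theta\in\operatorname{int}\Theta_P$, MEM and ML estimators exist, and the following hold. (a) (Primal analogy) Suppose that $S^*\cap\operatorname{int}\operatorname{dom}\psi_P^*\neq\emptyset$ and $\nabla\psi_P^*(S^*\cap\operatorname{int}\operatorname{dom}\psi_P^*)=S\cap\operatorname{int}\operatorname{dom}\psi_P$. Then every MEM estimator $y_{MEM}\in\operatorname{int}\operatorname{dom}\psi_P^*$ satisfies $y_{MEM}=\nabla\psi_P(\theta_{MEM})$ for some $\theta_{MEM}\in\operatorname{int}\Theta_P$ with $$\theta_{MEM}\in\operatorname{argmin}\{\mathrm{KL}(P_\theta\|P_{\hat\theta}):\theta\in S\cap\Theta_P\}.$$ If moreover $S^*$ is convex, then the MEM estimator $y_{MEM}$ is unique and lies in $\operatorname{int}\operatorname{dom}\psi_P^*$,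 the minimizer $\theta_{MEM}$ of $\theta\mapsto\mathrm{KL}(P_\theta\|P_{\hat\theta})$ over $S\cap\Theta_P$ is unique and lies in $\operatorname{int}\Theta_P$, and $y_{MEM}=\nabla\psi_P(\theta_{MEM})$. The ML estimators are exactly the elements of $$\operatorname{argmin}\{\mathrm{KL}(P_{\hat\theta}\|P_\theta):\theta\in S\cap\Theta_P\}.$$ (b) (Dual analogy) The MEM estimators are exactly the elements of $\operatorname{argmin}\{D_{\psi_P^*}(y,\hat y):y\in S^*\}$, and the ML estimators are exactly the elements of $\operatorname{argmin}\{D_{\psi_P}(\theta,\hat\theta):\theta\in S\}$. -/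

import Mathlib

open MeasureTheory Filter Topology Set InformationTheory

noncomputable section

namespace MEM

/-! ### Convex analysis for extended-real-valued functions on `ℝᵈ` -/

/-- The effective domain `dom f = {x : f x < +∞}`. -/
def dom {d : ℕ} (f : EuclideanSpace ℝ (Fin d) → EReal) : Set (EuclideanSpace ℝ (Fin d)) :=
  {x | f x < ⊤}

/-- The Fenchel conjugate `f*(y) = sup_x (⟨y, x⟩ - f x)`. -/
def conj {d : ℕ} (f : EuclideanSpace ℝ (Fin d) → EReal) (y : EuclideanSpace ℝ (Fin d)) : EReal :=
  ⨆ x : EuclideanSpace ℝ (Fin d), ((inner ℝ y x : ℝ) : EReal) - f x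

/-- The gradient of an extended-real-valued function (meaningful at points of the interior of the
domain of a proper function, where `f` is locally real-valued). -/
def grad {d : ℕ} (f : EuclideanSpace ℝ (Fin d) → EReal) (x : EuclideanSpace ℝ (Fin d)) :
    EuclideanSpace ℝ (Fin d) :=
  gradient (fun z => (f z).toReal) x

/-- Essential smoothness (of a proper convex function): the interior of the domain is nonempty,
`f` is differentiable there, and the norm of its gradient blows up at the boundary of the domain
(steepness). -/
def EssentiallySmooth {d : ℕ} (f : EuclideanSpace ℝ (Fin d) → EReal) : Prop :=
  (interior (dom f)).Nonempty ∧
  (∀ x ∈ interior (dom f), DifferentiableAt ℝ (fun z => (f z).toReal) x) ∧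
  ∀ (u : ℕ → EuclideanSpace ℝ (Fin d)) (xbar : EuclideanSpace ℝ (Fin d)),
    (∀ k, u k ∈ interior (dom f)) → xbar ∈ frontier (dom f) → Tendsto u atTop (𝓝 xbar) →
      Tendsto (fun k => ‖grad f (u k)‖) atTop atTop

/-- The Bregman distance `D_f(y, x) = f y - f x - ⟨∇f(x), y - x⟩`, for `x` in the interior of the
domain of `f`; it is `+∞` when `y ∉ dom f`. -/
def bregman {d : ℕ} (f : EuclideanSpace ℝ (Fin d) → EReal) (y x : EuclideanSpace ℝ (Fin d)) :
    EReal :=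
  f y - f x - ((inner ℝ (grad f x) (y - x) : ℝ) : EReal)

/-- The set `argmin {f x : x ∈ S}` of all minimizers of `f` over `S`. -/
def argmin {α β : Type*} [Preorder β] (f : α → β) (S : Set α) : Set α :=
  {x | x ∈ S ∧ ∀ z ∈ S, f x ≤ f z}

/-- The set `argmax {f x : x ∈ S}` of all maximizers of `f` over `S`. -/
def argmax {α β : Type*} [Preorder β] (f : α → β) (S : Set α) : Set α :=
  {x | x ∈ S ∧ ∀ z ∈ S, f z ≤ f x}

/-! ### Measures and exponential families -/

/-- The two admissible settings: `Ω = ℝᵈ` with `P` absolutely continuous with respect to Lebesgue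
measure, or `Ω` countable with `P` absolutely continuous with respect to the counting measure
of `Ω` (that is, `P` lives on `Ω`). Measures on `Ω` are seen as measures on `ℝᵈ`. -/
def Dominated {d : ℕ} (Ω : Set (EuclideanSpace ℝ (Fin d)))
    (P : Measure (EuclideanSpace ℝ (Fin d))) : Prop :=
  (Ω = univ ∧ P ≪ volume) ∨ (Ω.Countable ∧ P ≪ Measure.count.restrict Ω)

/-- The support `Ω_P` of a measure `P` on `Ω`: the smallest relatively closed subset of `Ω` of full
measure. -/
def suppIn {d : ℕ} (Ω : Set (EuclideanSpace ℝ (Fin d)))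
    (P : Measure (EuclideanSpace ℝ (Fin d))) : Set (EuclideanSpace ℝ (Fin d)) :=
  Ω ∩ P.support

/-- The convex support `Ω_P^{cc}`: the closure of the convex hull of the support. -/
def convexSupport {d : ℕ} (Ω : Set (EuclideanSpace ℝ (Fin d)))
    (P : Measure (EuclideanSpace ℝ (Fin d))) : Set (EuclideanSpace ℝ (Fin d)) :=
  closure (convexHull ℝ (suppIn Ω P))

/-- The natural parameter space `Θ_P = {θ : ∫ exp⟨x, θ⟩ dP(x) < ∞}`. -/
def naturalSpace {d : ℕ} (P : Measure (EuclideanSpace ℝ (Fin d))) :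
    Set (EuclideanSpace ℝ (Fin d)) :=
  {θ | ∫⁻ x, ENNReal.ofReal (Real.exp (inner ℝ x θ)) ∂P < ⊤}

/-- The log-normalizer `ψ_P(θ) = log ∫ exp⟨x, θ⟩ dP(x)`, equal to `+∞` outside `Θ_P`. -/
def logNormalizer {d : ℕ} (P : Measure (EuclideanSpace ℝ (Fin d)))
    (θ : EuclideanSpace ℝ (Fin d)) : EReal :=
  ENNReal.log (∫⁻ x, ENNReal.ofReal (Real.exp (inner ℝ x θ)) ∂P)

/-- The density `f_{P_θ}(y) = exp(⟨y, θ⟩ - ψ_P(θ))` of the exponential family, `θ ∈ Θ_P`. -/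
def density {d : ℕ} (P : Measure (EuclideanSpace ℝ (Fin d)))
    (θ y : EuclideanSpace ℝ (Fin d)) : ℝ :=
  Real.exp (inner ℝ y θ - (logNormalizer P θ).toReal)

/-- The member `P_θ` of the exponential family generated by `P`: `dP_θ = f_{P_θ} dP`, for
`θ ∈ Θ_P`. -/
def expFamily {d : ℕ} (P : Measure (EuclideanSpace ℝ (Fin d)))
    (θ : EuclideanSpace ℝ (Fin d)) : Measure (EuclideanSpace ℝ (Fin d)) :=
  P.withDensity (fun x => ENNReal.ofReal (density P θ x))

/-- The exponential family generated by `P` is minimal: `Θ_P` and `Ω_P^{cc}` have full dimension. -/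
def Minimal {d : ℕ} (Ω : Set (EuclideanSpace ℝ (Fin d)))
    (P : Measure (EuclideanSpace ℝ (Fin d))) : Prop :=
  (interior (naturalSpace P)).Nonempty ∧ (interior (convexSupport Ω P)).Nonempty

/-- The exponential family generated by `P` is steep: its log-normalizer is essentially smooth. -/
def Steep {d : ℕ} (P : Measure (EuclideanSpace ℝ (Fin d))) : Prop :=
  EssentiallySmooth (logNormalizer P)

/-- The support is uncountable, or it is countable and its convex hull is closed. -/
def SupportCondition {d : ℕ} (Ω : Set (EuclideanSpace ℝ (Fin d)))
    (Q : Measure (EuclideanSpace ℝ (Fin d))) : Prop :=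
  ¬ (suppIn Ω Q).Countable ∨
    ((suppIn Ω Q).Countable ∧ IsClosed (convexHull ℝ (suppIn Ω Q)))

/-! ### The two estimators -/

/-- The set of MEM estimators for the observation `yhat`, the reference family `F` indexed by `Λ`
and the set `T` of admissible means: the minimizers over `T` of the Cramér rate function of the
reference distribution whose expected value exists and equals `yhat`. -/
def memEstimators {d : ℕ} (yhat : EuclideanSpace ℝ (Fin d)) (Λ : Set (EuclideanSpace ℝ (Fin d)))
    (F : EuclideanSpace ℝ (Fin d) → Measure (EuclideanSpace ℝ (Fin d)))
    (T : Set (EuclideanSpace ℝ (Fin d))) : Set (EuclideanSpace ℝ (Fin d)) :=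
  {y | ∃ l ∈ Λ, Integrable (fun x => x) (F l) ∧ ∫ x, x ∂(F l) = yhat ∧
    y ∈ argmin (conj (logNormalizer (F l))) T}

/-- The set of maximum likelihood estimators for the observation `yhat`, the exponential family
generated by `P` and the set `S` of admissible parameters. -/
def mlEstimators {d : ℕ} (yhat : EuclideanSpace ℝ (Fin d))
    (P : Measure (EuclideanSpace ℝ (Fin d))) (S : Set (EuclideanSpace ℝ (Fin d))) :
    Set (EuclideanSpace ℝ (Fin d)) :=
  argmax (fun θ => Real.log (density P θ yhat)) (S ∩ naturalSpace P)

end MEM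

end

/-! Everything rests on pairs `(y, θ)` with `IsSubgradient P y θ`: `θ ∈ Θ_P` and the affine function
of slope `y` touching `ψ_P` at `θ` lies below it. Steepness excludes boundary points of `Θ_P`
(`Steep.mem_interior`), so `y = ∇ψ_P(θ)` is the mean of `P_θ`. Full dimension of the convex support
makes Jensen's inequality strict, which upgrades the touching inequality to linear growth
(`IsSubgradient.exists_growth`). Hence `y ∈ int dom ψ_P*` and `∇ψ_P*(y) = θ`. Conversely, every `y`
in `int dom ψ_P*` or in the interior of the convex support has such a `θ`, found by minimizing `ψ_P
- ⟨y, ·⟩`.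

The rate function of `P_θhat` is `ψ_P*` plus the affine term `ψ_P(θhat) - ⟨y, θhat⟩`
(`conj_expFamily`). By Fenchel equality it is `D_{ψ_P*}(y, yhat)`, which gives the dual statement
for MEM. For a pair `(y, θ)` it also equals `KL(P_θ ‖ P_θhat)` (`coe_klDiv_expFamily`), so MEM
estimation becomes KL minimization under `∇ψ_P*`. Boundary parameters do not compete, because their
divergence is infinite (`mem_interior_of_klDiv_ne_top`). For convex `S*`,
`mem_interior_of_mem_argmin` places the minimizers in the interior and `eq_of_mem_argmin` makes them
unique. The ML statements hold because the negative log-likelihood, the reversed divergence and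
`D_{ψ_P}(·, θhat)` differ by constants on `Θ_P`. -/

namespace MEM

/-! ### Log-normalizer: tilting and convexity -/

section LogNormalizer

variable {d : ℕ} {P : Measure (EuclideanSpace ℝ (Fin d))}

/-- The real value of the log-normalizer, meaningful on the natural parameter space. -/
noncomputable def logZ (P : Measure (EuclideanSpace ℝ (Fin d)))
    (θ : EuclideanSpace ℝ (Fin d)) : ℝ :=
  (logNormalizer P θ).toReal

lemma dom_logNormalizer : dom (logNormalizer P) = naturalSpace P := by
  ext θ
  simp [dom, logNormalizer, naturalSpace, ENNReal.log_lt_top_iff]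

lemma logNormalizer_of_notMem {θ : EuclideanSpace ℝ (Fin d)} (hθ : θ ∉ naturalSpace P) :
    logNormalizer P θ = ⊤ := by
  rw [← dom_logNormalizer] at hθ
  simpa [dom] using hθ

lemma measurable_density (θ : EuclideanSpace ℝ (Fin d)) : Measurable (density P θ) := by
  unfold density
  fun_prop

lemma lintegral_exp_ne_zero [NeZero P] (f : EuclideanSpace ℝ (Fin d) → ℝ) (hf : Measurable f) :
    ∫⁻ x, ENNReal.ofReal (Real.exp (f x)) ∂P ≠ 0 := by
  intro h
  rw [lintegral_eq_zero_iff (by fun_prop)] at h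
  have h0 : ∀ᵐ x ∂P, False := by
    filter_upwards [h] with x hx
    have : Real.exp (f x) ≤ 0 := by simpa using hx
    exact absurd this (not_le.2 (Real.exp_pos _))
  have : P = 0 := by simpa [ae_iff] using h0
  exact NeZero.ne P this

lemma coe_logZ [NeZero P] {θ : EuclideanSpace ℝ (Fin d)} (hθ : θ ∈ naturalSpace P) :
    logNormalizer P θ = (logZ P θ : EReal) := by
  have h := ENNReal.log_pos_real (lintegral_exp_ne_zero (P := P) (fun x => inner ℝ x θ)
    (by fun_prop)) (ne_of_lt hθ)
  rw [logZ, logNormalizer, h, EReal.toReal_coe]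

lemma lintegral_exp_eq [NeZero P] {θ : EuclideanSpace ℝ (Fin d)} (hθ : θ ∈ naturalSpace P) :
    ∫⁻ x, ENNReal.ofReal (Real.exp (inner ℝ x θ)) ∂P = ENNReal.ofReal (Real.exp (logZ P θ)) := by
  have h0 := lintegral_exp_ne_zero (P := P) (fun x => inner ℝ x θ) (by fun_prop)
  have h1 : ∫⁻ x, ENNReal.ofReal (Real.exp (inner ℝ x θ)) ∂P ≠ ⊤ := ne_of_lt hθ
  have h := ENNReal.log_pos_real h0 h1
  rw [logZ, logNormalizer, h, EReal.toReal_coe, Real.exp_log (ENNReal.toReal_pos h0 h1),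
    ENNReal.ofReal_toReal h1]

lemma lintegral_exp_sub (θ : EuclideanSpace ℝ (Fin d)) (c : ℝ) :
    ∫⁻ x, ENNReal.ofReal (Real.exp (inner ℝ x θ - c)) ∂P =
      ENNReal.ofReal (Real.exp (-c)) * ∫⁻ x, ENNReal.ofReal (Real.exp (inner ℝ x θ)) ∂P := by
  rw [← lintegral_const_mul _ (by fun_prop)]
  congr 1; ext x
  rw [← ENNReal.ofReal_mul (Real.exp_pos _).le, ← Real.exp_add]
  ring_nf

lemma lintegral_exp_sub_eq [NeZero P] {θ : EuclideanSpace ℝ (Fin d)} (hθ : θ ∈ naturalSpace P)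
    (c : ℝ) : ∫⁻ x, ENNReal.ofReal (Real.exp (inner ℝ x θ - c)) ∂P =
      ENNReal.ofReal (Real.exp (logZ P θ - c)) := by
  rw [lintegral_exp_sub, lintegral_exp_eq hθ, ← ENNReal.ofReal_mul (Real.exp_pos _).le,
    ← Real.exp_add]
  ring_nf

lemma lintegral_exp_sub_lt_top_iff {θ : EuclideanSpace ℝ (Fin d)} (c : ℝ) :
    ∫⁻ x, ENNReal.ofReal (Real.exp (inner ℝ x θ - c)) ∂P < ⊤ ↔ θ ∈ naturalSpace P := by
  rw [lintegral_exp_sub]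
  constructor
  · intro h
    by_contra hn
    have : ∫⁻ x, ENNReal.ofReal (Real.exp (inner ℝ x θ)) ∂P = ⊤ := by
      simpa [naturalSpace] using hn
    rw [this, ENNReal.mul_top (by simp [Real.exp_pos])] at h
    exact lt_irrefl _ h
  · intro h
    exact ENNReal.mul_lt_top ENNReal.ofReal_lt_top h

lemma isProbabilityMeasure_expFamily [NeZero P] {θ : EuclideanSpace ℝ (Fin d)}
    (hθ : θ ∈ naturalSpace P) : IsProbabilityMeasure (expFamily P θ) := by
  constructor
  rw [expFamily, withDensity_apply _ MeasurableSet.univ, Measure.restrict_univ]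
  have := lintegral_exp_sub_eq hθ (logZ P θ)
  simpa [density, logZ] using this

lemma absolutelyContinuous_expFamily (θ : EuclideanSpace ℝ (Fin d)) : P ≪ expFamily P θ := by
  refine withDensity_absolutelyContinuous' (measurable_density θ).ennreal_ofReal.aemeasurable
    (ae_of_all _ fun x => ?_)
  simp [density, Real.exp_pos]

lemma lintegral_exp_expFamily (θ η : EuclideanSpace ℝ (Fin d)) :
    ∫⁻ x, ENNReal.ofReal (Real.exp (inner ℝ x η)) ∂(expFamily P θ) =
      ∫⁻ x, ENNReal.ofReal (Real.exp (inner ℝ x (θ + η) - logZ P θ)) ∂P := by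
  rw [expFamily, lintegral_withDensity_eq_lintegral_mul _ (measurable_density θ).ennreal_ofReal
    (by fun_prop)]
  congr 1; ext x
  simp only [Pi.mul_apply, density]
  rw [← ENNReal.ofReal_mul (Real.exp_pos _).le, ← Real.exp_add, inner_add_right, logZ]
  ring_nf

lemma mem_naturalSpace_expFamily {θ η : EuclideanSpace ℝ (Fin d)} :
    η ∈ naturalSpace (expFamily P θ) ↔ θ + η ∈ naturalSpace P := by
  rw [← lintegral_exp_sub_lt_top_iff (θ := θ + η) (logZ P θ), ← lintegral_exp_expFamily]
  rfl

lemma neZero_expFamily [NeZero P] (θ : EuclideanSpace ℝ (Fin d)) : NeZero (expFamily P θ) := by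
  refine ⟨fun h => NeZero.ne P ?_⟩
  have := absolutelyContinuous_expFamily (P := P) θ
  rw [h] at this
  exact Measure.absolutelyContinuous_zero_iff.1 this

/-- Tilting by `θ` and then by `η` is tilting by `θ + η`, up to normalization. This reduces
statements about a reference member `P_θ` to statements about `P`. -/
lemma logZ_expFamily [NeZero P] {θ η : EuclideanSpace ℝ (Fin d)} (h : θ + η ∈ naturalSpace P) :
    logZ (expFamily P θ) η = logZ P (θ + η) - logZ P θ := by
  have := neZero_expFamily (P := P) θ
  have h1 := lintegral_exp_expFamily (P := P) θ η
  rw [lintegral_exp_sub_eq h, lintegral_exp_eq (mem_naturalSpace_expFamily.2 h),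
    ENNReal.ofReal_eq_ofReal_iff (Real.exp_pos _).le (Real.exp_pos _).le] at h1
  exact Real.exp_injective h1

/-- Hölder's inequality in Young form: convexity of `exp` is applied pointwise to the normalized
exponents `⟨x, θᵢ⟩ - ψ_P(θᵢ)`, each of whose exponentials integrates to `1`. The single bound `key`
gives convexity of both the domain and the function. -/
lemma convexOn_logZ [NeZero P] : ConvexOn ℝ (naturalSpace P) (logZ P) := by
  have key : ∀ θ₁ ∈ naturalSpace P, ∀ θ₂ ∈ naturalSpace P, ∀ a b : ℝ, 0 ≤ a → 0 ≤ b →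
      a + b = 1 → ∫⁻ x, ENNReal.ofReal (Real.exp (inner ℝ x (a • θ₁ + b • θ₂) -
        (a * logZ P θ₁ + b * logZ P θ₂))) ∂P ≤ 1 := by
    intro θ₁ h₁ θ₂ h₂ a b ha hb hab
    calc _ ≤ ∫⁻ x, (ENNReal.ofReal a * ENNReal.ofReal (Real.exp (inner ℝ x θ₁ - logZ P θ₁)) +
          ENNReal.ofReal b * ENNReal.ofReal (Real.exp (inner ℝ x θ₂ - logZ P θ₂))) ∂P := by
          refine lintegral_mono fun x => ?_
          dsimp only
          rw [← ENNReal.ofReal_mul ha, ← ENNReal.ofReal_mul hb,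
            ← ENNReal.ofReal_add (by positivity) (by positivity)]
          refine ENNReal.ofReal_le_ofReal ?_
          have := convexOn_exp.2 (mem_univ (inner ℝ x θ₁ - logZ P θ₁))
            (mem_univ (inner ℝ x θ₂ - logZ P θ₂)) ha hb hab
          simp only [smul_eq_mul] at this
          refine le_trans (le_of_eq ?_) this
          rw [inner_add_right, inner_smul_right, inner_smul_right]
          ring_nf
      _ = 1 := by
          rw [lintegral_add_left (by fun_prop), lintegral_const_mul _ (by fun_prop),
            lintegral_const_mul _ (by fun_prop), lintegral_exp_sub_eq h₁, lintegral_exp_sub_eq h₂]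
          simp [← ENNReal.ofReal_add ha hb, hab]
  have hmem : Convex ℝ (naturalSpace P) := by
    intro θ₁ h₁ θ₂ h₂ a b ha hb hab
    exact (lintegral_exp_sub_lt_top_iff _).1
      ((key θ₁ h₁ θ₂ h₂ a b ha hb hab).trans_lt ENNReal.one_lt_top)
  refine ⟨hmem, ?_⟩
  intro θ₁ h₁ θ₂ h₂ a b ha hb hab
  have h := key θ₁ h₁ θ₂ h₂ a b ha hb hab
  rw [lintegral_exp_sub_eq (hmem h₁ h₂ ha hb hab), ENNReal.ofReal_le_one, Real.exp_le_one_iff] at h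
  simp only [smul_eq_mul]
  linarith

end LogNormalizer

/-! ### Lower semicontinuity and existence of minimizers -/

section Semicontinuity

/-- Fatou's lemma along `𝓝 θ`, which first countability makes countably generated. -/
lemma lowerSemicontinuous_lintegral {α X : Type*} [MeasurableSpace α] {μ : Measure α}
    [TopologicalSpace X] [FirstCountableTopology X] {f : X → α → ENNReal}
    (hm : ∀ θ, Measurable (f θ)) (hc : ∀ x, Continuous fun θ => f θ x) :
    LowerSemicontinuous fun θ => ∫⁻ x, f θ x ∂μ := by
  rw [lowerSemicontinuous_iff_le_liminf]
  intro θ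
  refine le_trans (le_of_eq ?_) (lintegral_liminf_le hm)
  congr 1; ext x
  exact (((hc x).tendsto θ).liminf_eq).symm

lemma exists_mem_argmin {X β : Type*} [PseudoMetricSpace X] [ProperSpace X] [LinearOrder β]
    {f : X → β} (hf : LowerSemicontinuous f) {S : Set X} (hS : IsClosed S) {x₀ : X} (hx₀ : x₀ ∈ S)
    (hb : Bornology.IsBounded {x | f x ≤ f x₀}) : (argmin f S).Nonempty := by
  have hmem : x₀ ∈ S ∩ closure {x | f x ≤ f x₀} :=
    ⟨hx₀, subset_closure (show f x₀ ≤ f x₀ from le_rfl)⟩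
  have hK : IsCompact (S ∩ closure {x | f x ≤ f x₀}) :=
    IsCompact.inter_left (Metric.isCompact_of_isClosed_isBounded isClosed_closure hb.closure) hS
  obtain ⟨a, ha, hmin⟩ := LowerSemicontinuousOn.exists_isMinOn ⟨x₀, hmem⟩ hK
    (hf.lowerSemicontinuousOn _)
  refine ⟨a, ha.1, fun z hz => ?_⟩
  have h0 : f a ≤ f x₀ := hmin hmem
  rcases le_total (f z) (f x₀) with h | h
  · exact hmin ⟨hz, subset_closure h⟩
  · exact h0.trans h

lemma lowerSemicontinuous_conj {d : ℕ} (f : EuclideanSpace ℝ (Fin d) → EReal) :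
    LowerSemicontinuous (conj f) := by
  refine lowerSemicontinuous_iSup fun x => Continuous.lowerSemicontinuous ?_
  induction f x with
  | bot => simpa using continuous_const
  | top => simpa using continuous_const
  | coe r =>
    have : Continuous fun y : EuclideanSpace ℝ (Fin d) => ((inner ℝ y x - r : ℝ) : EReal) :=
      continuous_coe_real_ereal.comp (by fun_prop)
    simpa using this

end Semicontinuity

/-! ### Jensen's inequality and integrability of the identity -/

section Jensen

variable {d : ℕ} {Q : Measure (EuclideanSpace ℝ (Fin d))} [IsProbabilityMeasure Q]

lemma integrable_exp_of_mem_naturalSpace {Q : Measure (EuclideanSpace ℝ (Fin d))}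
    {η : EuclideanSpace ℝ (Fin d)} (hη : η ∈ naturalSpace Q) :
    Integrable (fun x => Real.exp (inner ℝ x η)) Q := by
  refine ⟨by fun_prop, ?_⟩
  rw [hasFiniteIntegral_iff_ofReal (ae_of_all _ fun x => (Real.exp_pos _).le)]
  exact hη

lemma integral_exp_eq {η : EuclideanSpace ℝ (Fin d)} (hη : η ∈ naturalSpace Q) :
    ∫ x, Real.exp (inner ℝ x η) ∂Q = Real.exp (logZ Q η) := by
  rw [integral_eq_lintegral_of_nonneg_ae (ae_of_all _ fun x => (Real.exp_pos _).le) (by fun_prop),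
    lintegral_exp_eq hη, ENNReal.toReal_ofReal (Real.exp_pos _).le]

lemma integral_inner_le_logZ {η : EuclideanSpace ℝ (Fin d)} (hη : η ∈ naturalSpace Q)
    (hi : Integrable (fun x => (inner ℝ x η : ℝ)) Q) : ∫ x, (inner ℝ x η : ℝ) ∂Q ≤ logZ Q η := by
  have h := convexOn_exp.map_integral_le (μ := Q) (f := fun x => (inner ℝ x η : ℝ))
    Real.continuous_exp.continuousOn isClosed_univ (ae_of_all _ fun _ => mem_univ _) hi
    (integrable_exp_of_mem_naturalSpace hη)
  rw [integral_exp_eq hη] at h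
  exact Real.exp_le_exp.1 h

lemma integral_inner_lt_logZ {η : EuclideanSpace ℝ (Fin d)} (hη : η ∈ naturalSpace Q)
    (hi : Integrable (fun x => (inner ℝ x η : ℝ)) Q)
    (hc : ¬ ∃ c : ℝ, ∀ᵐ x ∂Q, (inner ℝ x η : ℝ) = c) :
    ∫ x, (inner ℝ x η : ℝ) ∂Q < logZ Q η := by
  rcases strictConvexOn_exp.ae_eq_const_or_map_average_lt (μ := Q)
    (f := fun x => (inner ℝ x η : ℝ))
    Real.continuous_exp.continuousOn isClosed_univ (ae_of_all _ fun _ => mem_univ _) hi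
    (integrable_exp_of_mem_naturalSpace hη) with h | h
  · exact absurd ⟨_, h⟩ hc
  · rw [average_eq_integral, average_eq_integral, integral_exp_eq hη] at h
    exact Real.exp_lt_exp.1 h

/-- Each coordinate is dominated through `|s| ≤ exp s + exp (-s)` with `s = (ε / 2) * ⟨x, e⟩`, both
exponentials being integrable because `±(ε / 2) • e` lies in the natural space. -/
lemma integrable_id_of_zero_mem_interior {Q : Measure (EuclideanSpace ℝ (Fin d))}
    (h : (0 : EuclideanSpace ℝ (Fin d)) ∈ interior (naturalSpace Q)) :
    Integrable (fun x => x) Q := by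
  obtain ⟨ε, hε, hball⟩ := Metric.mem_nhds_iff.1 (mem_interior_iff_mem_nhds.1 h)
  have hcoord : ∀ i, Integrable (fun x : EuclideanSpace ℝ (Fin d) =>
      (inner ℝ x (EuclideanSpace.single i (1 : ℝ)) : ℝ)) Q := by
    intro i
    set e := EuclideanSpace.single i (1 : ℝ) with he
    have hen : ‖e‖ = 1 := by simp [he]
    have hmem : ∀ s : ℝ, |s| < ε → s • e ∈ naturalSpace Q := fun s hs => by
      apply hball
      simpa [norm_smul, hen] using hs
    have h1 := integrable_exp_of_mem_naturalSpace (hmem (ε / 2) (by rw [abs_of_pos] <;> linarith))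
    have h2 := integrable_exp_of_mem_naturalSpace
      (hmem (-(ε / 2)) (by rw [abs_neg, abs_of_pos] <;> linarith))
    refine ((h1.add h2).const_mul (2 / ε)).mono' (by fun_prop) (ae_of_all _ fun x => ?_)
    simp only [Pi.add_apply, inner_smul_right, Real.norm_eq_abs]
    have hs : |ε / 2 * inner ℝ x e| ≤
        Real.exp (ε / 2 * inner ℝ x e) + Real.exp (-(ε / 2) * inner ℝ x e) := by
      have a1 := Real.add_one_le_exp (ε / 2 * inner ℝ x e)
      have a2 := Real.add_one_le_exp (-(ε / 2) * inner ℝ x e)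
      have a3 := Real.exp_pos (ε / 2 * inner ℝ x e)
      have a4 := Real.exp_pos (-(ε / 2) * inner ℝ x e)
      rw [abs_le]
      constructor <;> linarith
    rw [abs_mul, abs_of_pos (half_pos hε)] at hs
    calc |inner ℝ x e| = 2 / ε * (ε / 2 * |inner ℝ x e|) := by field_simp
      _ ≤ _ := by gcongr
  have hsum : (fun x : EuclideanSpace ℝ (Fin d) => x) = fun x =>
      ∑ i, (inner ℝ x (EuclideanSpace.single i (1 : ℝ)) : ℝ) • EuclideanSpace.single i (1 : ℝ) := by
    ext x j
    simp [EuclideanSpace.inner_single_right, Finset.sum_apply, Pi.single_apply]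
  rw [hsum]
  exact integrable_finsetSum _ fun i _ => (hcoord i).smul_const _

end Jensen

/-! ### Means as subgradients of the log-normalizer -/

section Subgradient

variable {d : ℕ} {P : Measure (EuclideanSpace ℝ (Fin d))}

/-- `y` is a subgradient of the log-normalizer at the point `θ` of the natural parameter space. -/
def IsSubgradient (P : Measure (EuclideanSpace ℝ (Fin d)))
    (y θ : EuclideanSpace ℝ (Fin d)) : Prop :=
  θ ∈ naturalSpace P ∧ ∀ θ' ∈ naturalSpace P, logZ P θ + inner ℝ y (θ' - θ) ≤ logZ P θ'

/-- Jensen under `P_θ`. Integrability is asked only in the direction `θ' - θ`, since that is all a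
finite divergence supplies at a possible boundary point. -/
lemma logZ_add_integral_le [NeZero P] {θ θ' : EuclideanSpace ℝ (Fin d)} (hθ : θ ∈ naturalSpace P)
    (hθ' : θ' ∈ naturalSpace P)
    (hi : Integrable (fun x => (inner ℝ x (θ' - θ) : ℝ)) (expFamily P θ)) :
    logZ P θ + ∫ x, (inner ℝ x (θ' - θ) : ℝ) ∂(expFamily P θ) ≤ logZ P θ' := by
  have := isProbabilityMeasure_expFamily hθ
  have hmem : θ + (θ' - θ) ∈ naturalSpace P := by simpa using hθ'
  have h := integral_inner_le_logZ (mem_naturalSpace_expFamily.2 hmem) hi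
  rw [logZ_expFamily hmem, add_sub_cancel] at h
  linarith

lemma integral_inner_eq {Q : Measure (EuclideanSpace ℝ (Fin d))}
    (hi : Integrable (fun x => x) Q) (v : EuclideanSpace ℝ (Fin d)) :
    ∫ x, (inner ℝ x v : ℝ) ∂Q = inner ℝ (∫ x, x ∂Q) v := by
  rw [real_inner_comm, ← integral_inner hi]
  simp_rw [real_inner_comm]

lemma isSubgradient_integral [NeZero P] {θ : EuclideanSpace ℝ (Fin d)} (hθ : θ ∈ naturalSpace P)
    (hi : Integrable (fun x => x) (expFamily P θ)) :
    IsSubgradient P (∫ x, x ∂(expFamily P θ)) θ := by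
  refine ⟨hθ, fun θ' hθ' => ?_⟩
  rw [← integral_inner_eq hi]
  exact logZ_add_integral_le hθ hθ' (hi.inner_const _)

lemma zero_mem_interior_naturalSpace_expFamily {θ : EuclideanSpace ℝ (Fin d)}
    (hθ : θ ∈ interior (naturalSpace P)) :
    (0 : EuclideanSpace ℝ (Fin d)) ∈ interior (naturalSpace (expFamily P θ)) := by
  have hc : Continuous fun η : EuclideanSpace ℝ (Fin d) => θ + η := by fun_prop
  have : naturalSpace (expFamily P θ) = (fun η => θ + η) ⁻¹' naturalSpace P := by
    ext η; exact mem_naturalSpace_expFamily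
  rw [this]
  exact preimage_interior_subset_interior_preimage hc (by simpa using hθ)

lemma integrable_expFamily_of_mem_interior {θ : EuclideanSpace ℝ (Fin d)}
    (hθ : θ ∈ interior (naturalSpace P)) : Integrable (fun x => x) (expFamily P θ) :=
  integrable_id_of_zero_mem_interior (zero_mem_interior_naturalSpace_expFamily hθ)

end Subgradient

/-! ### Convex support and strictness -/

section ConvexSupport

variable {d : ℕ} {P : Measure (EuclideanSpace ℝ (Fin d))} {Ω : Set (EuclideanSpace ℝ (Fin d))}

lemma convexSupport_subset {v : EuclideanSpace ℝ (Fin d)} {c : ℝ}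
    (h : ∀ᵐ x ∂P, (inner ℝ x v : ℝ) ≤ c) :
    convexSupport Ω P ⊆ {x | (inner ℝ x v : ℝ) ≤ c} := by
  have hcl : IsClosed {x : EuclideanSpace ℝ (Fin d) | (inner ℝ x v : ℝ) ≤ c} :=
    isClosed_le (by fun_prop) (by fun_prop)
  have hconv : Convex ℝ {x : EuclideanSpace ℝ (Fin d) | (inner ℝ x v : ℝ) ≤ c} := by
    refine convex_halfSpace_le ⟨fun x y => inner_add_left _ _ _, fun a x => ?_⟩ c
    simp [inner_smul_left]
  refine closure_minimal (convexHull_min ?_ hconv) hcl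
  exact inter_subset_right.trans (Measure.support_subset_of_isClosed hcl h)

/-- A small step from `y` in the direction `v` stays in the convex support but leaves the
half-space, which would have to contain that support. -/
lemma not_ae_inner_le {y v : EuclideanSpace ℝ (Fin d)} (hy : y ∈ interior (convexSupport Ω P))
    (hv : v ≠ 0) {c : ℝ} (hc : c ≤ inner ℝ y v) : ¬ ∀ᵐ x ∂P, (inner ℝ x v : ℝ) ≤ c := by
  intro h
  have hsub := convexSupport_subset (Ω := Ω) h
  have hev : ∀ᶠ t : ℝ in 𝓝 0, y + t • v ∈ convexSupport Ω P := by
    have hcont : ContinuousAt (fun t : ℝ => y + t • v) 0 := by fun_prop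
    exact hcont.eventually_mem (by simpa using mem_interior_iff_mem_nhds.1 hy)
  obtain ⟨ε, hε, hb⟩ := Metric.eventually_nhds_iff.1 hev
  have h1 := hsub (hb (y := ε / 2) (by simp [abs_of_pos hε]; linarith))
  simp only [mem_ofPred_eq, inner_add_left, inner_smul_left, real_inner_self_eq_norm_sq] at h1
  have : 0 < ε / 2 * ‖v‖ ^ 2 := by positivity
  simp only [conj_trivial] at h1
  linarith

lemma not_ae_inner_eq {y v : EuclideanSpace ℝ (Fin d)} (hy : y ∈ interior (convexSupport Ω P))
    (hv : v ≠ 0) : ¬ ∃ c : ℝ, ∀ᵐ x ∂P, (inner ℝ x v : ℝ) = c := by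
  rintro ⟨c, h⟩
  rcases le_total c (inner ℝ y v) with hc | hc
  · exact not_ae_inner_le hy hv hc (h.mono fun x hx => hx.le)
  · refine not_ae_inner_le (v := -v) (c := -c) hy (neg_ne_zero.2 hv) ?_ ?_
    · rw [inner_neg_right]; linarith
    · filter_upwards [h] with x hx
      rw [inner_neg_right, hx]

/-- Equality in Jensen would make `⟨x, θ' - θ⟩` almost surely constant, forcing the convex support
into a hyperplane. -/
lemma logZ_add_inner_lt [NeZero P] (hne : (interior (convexSupport Ω P)).Nonempty)
    {θ θ' : EuclideanSpace ℝ (Fin d)} (hθ : θ ∈ naturalSpace P)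
    (hi : Integrable (fun x => x) (expFamily P θ)) (hθ' : θ' ∈ naturalSpace P) (hne' : θ' ≠ θ) :
    logZ P θ + inner ℝ (∫ x, x ∂(expFamily P θ)) (θ' - θ) < logZ P θ' := by
  obtain ⟨y, hy⟩ := hne
  have := isProbabilityMeasure_expFamily hθ
  have hmem : θ + (θ' - θ) ∈ naturalSpace P := by simpa using hθ'
  have h := integral_inner_lt_logZ (mem_naturalSpace_expFamily.2 hmem) (hi.inner_const _) (by
    rintro ⟨c, hc⟩
    exact not_ae_inner_eq hy (sub_ne_zero.2 hne')
      ⟨c, (absolutelyContinuous_expFamily θ).ae_le hc⟩)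
  rw [logZ_expFamily hmem, add_sub_cancel, integral_inner_eq hi] at h
  linarith

end ConvexSupport

/-! ### Kullback–Leibler divergence within the family -/

section Divergence

variable {d : ℕ} {P : Measure (EuclideanSpace ℝ (Fin d))}
  {θ₁ θ₂ : EuclideanSpace ℝ (Fin d)}

lemma expFamily_eq_withDensity :
    expFamily P θ₁ = (expFamily P θ₂).withDensity
      (fun x => ENNReal.ofReal (Real.exp (inner ℝ x (θ₁ - θ₂) - logZ P θ₁ + logZ P θ₂))) := by
  rw [expFamily, expFamily, ← withDensity_mul _ (measurable_density θ₂).ennreal_ofReal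
    (by fun_prop)]
  congr 1; ext x
  simp only [Pi.mul_apply, density]
  rw [← ENNReal.ofReal_mul (Real.exp_pos _).le, ← Real.exp_add, inner_sub_right, logZ, logZ]
  ring_nf

lemma expFamily_absolutelyContinuous : expFamily P θ₁ ≪ expFamily P θ₂ := by
  rw [expFamily_eq_withDensity (θ₁ := θ₁) (θ₂ := θ₂)]
  exact withDensity_absolutelyContinuous _ _

lemma llr_expFamily [NeZero P] (h₂ : θ₂ ∈ naturalSpace P) :
    llr (expFamily P θ₁) (expFamily P θ₂) =ᵐ[expFamily P θ₁]
      fun x => inner ℝ x (θ₁ - θ₂) - logZ P θ₁ + logZ P θ₂ := by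
  have := isProbabilityMeasure_expFamily h₂
  have h := Measure.rnDeriv_withDensity (expFamily P θ₂)
    (f := fun x => ENNReal.ofReal (Real.exp (inner ℝ x (θ₁ - θ₂) - logZ P θ₁ + logZ P θ₂)))
    (by fun_prop)
  rw [← expFamily_eq_withDensity] at h
  filter_upwards [expFamily_absolutelyContinuous.ae_le h] with x hx
  rw [llr, hx, ENNReal.toReal_ofReal (Real.exp_pos _).le, Real.log_exp]

lemma integrable_inner_of_klDiv_ne_top [NeZero P] (h₁ : θ₁ ∈ naturalSpace P)
    (h₂ : θ₂ ∈ naturalSpace P)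
    (h : klDiv (expFamily P θ₁) (expFamily P θ₂) ≠ ⊤) :
    Integrable (fun x => (inner ℝ x (θ₁ - θ₂) : ℝ)) (expFamily P θ₁) := by
  have := isProbabilityMeasure_expFamily h₁
  have hi := (integrable_congr (llr_expFamily h₂)).1 (klDiv_ne_top_iff.1 h).2
  have := hi.add (integrable_const (logZ P θ₁ - logZ P θ₂))
  refine this.congr (ae_of_all _ fun x => ?_)
  simp only [Pi.add_apply]
  ring

/-- The log-likelihood ratio is affine in `x`, so its integral depends on `x` only through the mean
of `P_{θ₁}`. -/
lemma klDiv_expFamily [NeZero P] (h₁ : θ₁ ∈ naturalSpace P) (h₂ : θ₂ ∈ naturalSpace P)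
    (hi : Integrable (fun x => x) (expFamily P θ₁)) :
    klDiv (expFamily P θ₁) (expFamily P θ₂) = ENNReal.ofReal
      (logZ P θ₂ - logZ P θ₁ - inner ℝ (∫ x, x ∂(expFamily P θ₁)) (θ₂ - θ₁)) := by
  have := isProbabilityMeasure_expFamily h₁
  have := isProbabilityMeasure_expFamily h₂
  have hinn : Integrable (fun x => (inner ℝ x (θ₁ - θ₂) : ℝ)) (expFamily P θ₁) := hi.inner_const _
  have hsub : Integrable (fun x => (inner ℝ x (θ₁ - θ₂) : ℝ) - logZ P θ₁) (expFamily P θ₁) :=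
    hinn.sub (integrable_const _)
  have hll := llr_expFamily (P := P) (θ₁ := θ₁) h₂
  rw [klDiv_of_ac_of_integrable expFamily_absolutelyContinuous
    ((integrable_congr hll).2 (hsub.add (integrable_const _))),
    integral_congr_ae hll, integral_add hsub (integrable_const _),
    integral_sub hinn (integrable_const _), integral_inner_eq hi]
  congr 1
  simp only [integral_const, probReal_univ, smul_eq_mul, inner_sub_right]
  ring

end Divergence

/-! ### Consequences of steepness, linear growth and subgradients -/

section Steepness

variable {d : ℕ} {P : Measure (EuclideanSpace ℝ (Fin d))} {Ω : Set (EuclideanSpace ℝ (Fin d))}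

lemma Steep.differentiableAt (hs : Steep P) {θ : EuclideanSpace ℝ (Fin d)}
    (hθ : θ ∈ interior (naturalSpace P)) : DifferentiableAt ℝ (logZ P) θ := by
  rw [← dom_logNormalizer] at hθ
  exact hs.2.1 θ hθ

/-- At `θ` the function `ψ_P - ⟨y, ·⟩` has a local minimum, so its derivative vanishes there. -/
lemma IsSubgradient.grad_eq (hs : Steep P) {y θ : EuclideanSpace ℝ (Fin d)}
    (h : IsSubgradient P y θ) (hθ : θ ∈ interior (naturalSpace P)) :
    grad (logNormalizer P) θ = y := by
  have hg : HasGradientAt (logZ P) (grad (logNormalizer P) θ) θ :=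
    (hs.differentiableAt hθ).hasGradientAt
  have hl : HasFDerivAt (fun θ' => logZ P θ' - inner ℝ y θ')
      (innerSL ℝ (grad (logNormalizer P) θ) - innerSL ℝ y) θ :=
    (hasGradientAt_iff_hasFDerivAt.1 hg).sub (innerSL ℝ y).hasFDerivAt
  have hmin : IsLocalMin (fun θ' => logZ P θ' - inner ℝ y θ') θ := by
    filter_upwards [mem_interior_iff_mem_nhds.1 hθ] with θ' hθ'
    have := h.2 θ' hθ'
    rw [inner_sub_right] at this
    linarith
  have h0 := hmin.hasFDerivAt_eq_zero hl
  refine ext_inner_right ℝ fun v => ?_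
  have := DFunLike.congr_fun h0 v
  simp only [sub_apply, innerSL_apply_apply,
    zero_apply] at this
  linarith

/-- Along a segment from a point of the natural parameter space to an interior point, the slope of
a steep log-normalizer at the starting point is bounded below only if this point is interior. -/
lemma Steep.mem_interior [NeZero P] (hs : Steep P) {θ θ₀ : EuclideanSpace ℝ (Fin d)}
    (hθ : θ ∈ naturalSpace P) (hθ₀ : θ₀ ∈ interior (naturalSpace P)) {a : ℝ}
    (ha : ∀ t ∈ Ioc (0 : ℝ) 1, logZ P θ + t * a ≤ logZ P (θ + t • (θ₀ - θ))) :
    θ ∈ interior (naturalSpace P) := by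
  by_contra hn
  have hfr : θ ∈ frontier (dom (logNormalizer P)) := by
    rw [dom_logNormalizer]; exact ⟨subset_closure hθ, hn⟩
  let t : ℕ → ℝ := fun n => 1 / ((n : ℝ) + 1)
  have ht : ∀ n, t n ∈ Ioc (0 : ℝ) 1 := fun n =>
    ⟨by positivity, by
      rw [div_le_one (by positivity)]
      have : (0 : ℝ) ≤ n := n.cast_nonneg
      linarith⟩
  have ht0 : Tendsto t atTop (𝓝 0) := tendsto_one_div_add_atTop_nhds_zero_nat
  let u : ℕ → EuclideanSpace ℝ (Fin d) := fun n => θ + t n • (θ₀ - θ)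
  have hu : ∀ n, u n ∈ interior (naturalSpace P) := fun n => by
    have := (convexOn_logZ (P := P)).1.combo_interior_self_mem_interior hθ₀ hθ (ht n).1
      (sub_nonneg.2 (ht n).2) (by ring)
    convert this using 1
    simp only [u]
    module
  have hlim : Tendsto u atTop (𝓝 θ) := by
    have := (ht0.smul_const (θ₀ - θ)).const_add θ
    simpa [u] using this
  have hblow := hs.2.2 u θ (fun n => by rw [dom_logNormalizer]; exact hu n) hfr hlim
  obtain ⟨r, hr, M, hM⟩ : ∃ r > 0, ∃ M, ∀ z, dist z θ₀ ≤ r → z ∈ naturalSpace P ∧ logZ P z ≤ M := by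
    have h1 : ∀ᶠ z in 𝓝 θ₀, z ∈ naturalSpace P ∧ logZ P z ≤ logZ P θ₀ + 1 := by
      filter_upwards [mem_interior_iff_mem_nhds.1 hθ₀, (hs.differentiableAt hθ₀).continuousAt
        (Iic_mem_nhds (lt_add_one (logZ P θ₀)))] with z hz hz'
      exact ⟨hz, hz'⟩
    obtain ⟨r, hr, h⟩ := Metric.eventually_nhds_iff.1 h1
    exact ⟨r / 2, half_pos hr, _, fun z hz => h (by linarith)⟩
  -- This contradicts the blow-up of gradients. The subgradient inequality at `θ` together with `ha`
  -- gives `⟨G, θ₀ - θ⟩ ≥ a`; testing it at `θ₀ + (r / ‖G‖) • G`, where `ψ_P ≤ M`, then bounds `r *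
  -- ‖G‖`. The two copies of `|a|` absorb the terms with factors `1 - t n` and `t n`.
  have hbound : ∀ n, ‖grad (logNormalizer P) (u n)‖ ≤ (M - logZ P θ + 2 * |a|) / r := by
    intro n
    have hi := integrable_expFamily_of_mem_interior (hu n)
    have hsub := isSubgradient_integral (interior_subset (hu n)) hi
    rw [← hsub.grad_eq hs (hu n)] at hsub
    set G := grad (logNormalizer P) (u n)
    have htn := ht n
    have h1 := hsub.2 θ hθ
    have e1 : θ - u n = -(t n • (θ₀ - θ)) := by simp [u]
    have e2 : θ₀ - u n = (1 - t n) • (θ₀ - θ) := by simp only [u]; module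
    rw [e1, inner_neg_right, inner_smul_right] at h1
    have h2 := ha (t n) htn
    change _ ≤ logZ P (u n) at h2
    have h3 : a ≤ inner ℝ G (θ₀ - θ) := by
      have : t n * a ≤ t n * inner ℝ G (θ₀ - θ) := by linarith
      exact le_of_mul_le_mul_left this htn.1
    rcases eq_or_ne G 0 with hG | hG
    · rw [hG, norm_zero]
      refine div_nonneg ?_ hr.le
      have h4 := (hM θ₀ (by simpa using hr.le)).2
      have h5 := ha 1 ⟨one_pos, le_rfl⟩
      simp only [one_mul, one_smul, add_sub_cancel] at h5
      have := neg_abs_le a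
      have := abs_nonneg a
      linarith
    · have hGn : 0 < ‖G‖ := norm_pos_iff.2 hG
      obtain ⟨hz, hzM⟩ := hM (θ₀ + (r / ‖G‖) • G) (by
        rw [dist_eq_norm, add_sub_cancel_left, norm_smul, Real.norm_of_nonneg (by positivity)]
        field_simp; rfl)
      have h4 := hsub.2 _ hz
      have e3 : θ₀ + (r / ‖G‖) • G - u n = (1 - t n) • (θ₀ - θ) + (r / ‖G‖) • G := by
        rw [← e2]; abel
      rw [e3, inner_add_right, inner_smul_right, inner_smul_right,
        real_inner_self_eq_norm_sq] at h4
      have h5 : r / ‖G‖ * ‖G‖ ^ 2 = r * ‖G‖ := by field_simp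
      have h6 : -|a| ≤ (1 - t n) * inner ℝ G (θ₀ - θ) := by
        have h7 := mul_le_mul_of_nonneg_left h3 (sub_nonneg.2 htn.2)
        have h8 : -|a| ≤ (1 - t n) * a := by
          have := neg_abs_le ((1 - t n) * a)
          rw [abs_mul, abs_of_nonneg (sub_nonneg.2 htn.2)] at this
          have := mul_nonneg htn.1.le (abs_nonneg a)
          linarith
        linarith
      have h7 : -|a| ≤ t n * a := by
        have := neg_abs_le (t n * a)
        rw [abs_mul, abs_of_nonneg htn.1.le] at this
        have := mul_nonneg (sub_nonneg.2 htn.2) (abs_nonneg a)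
        linarith
      rw [le_div_iff₀ hr]
      linarith
  obtain ⟨n, hn⟩ := (hblow.eventually_gt_atTop ((M - logZ P θ + 2 * |a|) / r)).exists
  exact absurd (hbound n) (not_le.2 hn)

lemma IsSubgradient.mem_interior [NeZero P] (hs : Steep P) {y θ : EuclideanSpace ℝ (Fin d)}
    (h : IsSubgradient P y θ) : θ ∈ interior (naturalSpace P) := by
  obtain ⟨θ₀, hθ₀⟩ := hs.1
  rw [dom_logNormalizer] at hθ₀
  refine hs.mem_interior h.1 hθ₀ (a := inner ℝ y (θ₀ - θ)) fun t ht => ?_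
  have hmem : θ + t • (θ₀ - θ) ∈ naturalSpace P :=
    (convexOn_logZ (P := P)).1.add_smul_sub_mem h.1 (interior_subset hθ₀) ⟨ht.1.le, ht.2⟩
  have := h.2 _ hmem
  rwa [add_sub_cancel_left, inner_smul_right] at this

lemma integral_expFamily_eq_grad [NeZero P] (hs : Steep P) {θ : EuclideanSpace ℝ (Fin d)}
    (hθ : θ ∈ interior (naturalSpace P)) :
    ∫ x, x ∂(expFamily P θ) = grad (logNormalizer P) θ :=
  ((isSubgradient_integral (interior_subset hθ)
    (integrable_expFamily_of_mem_interior hθ)).grad_eq hs hθ).symm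

lemma IsSubgradient.lt [NeZero P] (hs : Steep P) (hne : (interior (convexSupport Ω P)).Nonempty)
    {y θ θ' : EuclideanSpace ℝ (Fin d)} (h : IsSubgradient P y θ) (hθ' : θ' ∈ naturalSpace P)
    (hn : θ' ≠ θ) : logZ P θ + inner ℝ y (θ' - θ) < logZ P θ' := by
  have hθ := h.mem_interior hs
  rw [← h.grad_eq hs hθ, ← integral_expFamily_eq_grad hs hθ]
  exact logZ_add_inner_lt hne h.1 (integrable_expFamily_of_mem_interior hθ) hθ' hn

/-- The moment generating function of the translate of `P` by `-y`. -/
noncomputable def tilt (P : Measure (EuclideanSpace ℝ (Fin d)))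
    (y θ : EuclideanSpace ℝ (Fin d)) : ENNReal :=
  ∫⁻ x, ENNReal.ofReal (Real.exp (inner ℝ x θ - inner ℝ y θ)) ∂P

lemma tilt_eq [NeZero P] {y θ : EuclideanSpace ℝ (Fin d)} (hθ : θ ∈ naturalSpace P) :
    tilt P y θ = ENNReal.ofReal (Real.exp (logZ P θ - inner ℝ y θ)) :=
  lintegral_exp_sub_eq hθ _

lemma tilt_le_tilt_iff [NeZero P] {y θ θ' : EuclideanSpace ℝ (Fin d)} (hθ : θ ∈ naturalSpace P)
    (hθ' : θ' ∈ naturalSpace P) :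
    tilt P y θ ≤ tilt P y θ' ↔ logZ P θ - inner ℝ y θ ≤ logZ P θ' - inner ℝ y θ' := by
  rw [tilt_eq hθ, tilt_eq hθ', ENNReal.ofReal_le_ofReal_iff (Real.exp_pos _).le, Real.exp_le_exp]

lemma mem_naturalSpace_of_tilt_le {y θ θ' : EuclideanSpace ℝ (Fin d)}
    (hθ' : θ' ∈ naturalSpace P) (h : tilt P y θ ≤ tilt P y θ') : θ ∈ naturalSpace P :=
  (lintegral_exp_sub_lt_top_iff _).1
    (h.trans_lt ((lintegral_exp_sub_lt_top_iff (inner ℝ y θ')).2 hθ'))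

/-- Using the `ENNReal`-valued exponential of `ψ_P - ⟨y, ·⟩` lets Fatou cover points outside `Θ_P`,
where the value is `⊤`. -/
lemma lowerSemicontinuous_tilt (y : EuclideanSpace ℝ (Fin d)) :
    LowerSemicontinuous (tilt P y) := by
  refine lowerSemicontinuous_lintegral (fun θ => by fun_prop) fun x => ?_
  exact ENNReal.continuous_ofReal.comp (by fun_prop)

/-- Linear growth of the log-normalizer away from a point with a given subgradient. -/
lemma IsSubgradient.exists_growth [NeZero P] (hs : Steep P)
    (hne : (interior (convexSupport Ω P)).Nonempty) {y θ : EuclideanSpace ℝ (Fin d)}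
    (h : IsSubgradient P y θ) {r : ℝ} (hr : 0 < r) :
    ∃ c > 0, ∀ θ' ∈ naturalSpace P, r ≤ ‖θ' - θ‖ →
      logZ P θ + inner ℝ y (θ' - θ) + c * ‖θ' - θ‖ ≤ logZ P θ' := by
  -- The excess over the affine minorant is strictly positive off `θ`, and semicontinuity gives it a
  -- positive lower bound `k` on the sphere. If the sphere is empty, or its minimizer of `tilt` lies
  -- outside `Θ_P`, no parameter is concerned and `1` serves.
  obtain ⟨k, hk, hsph⟩ : ∃ k > 0, ∀ θ' ∈ naturalSpace P, ‖θ' - θ‖ = r →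
      k ≤ logZ P θ' - logZ P θ - inner ℝ y (θ' - θ) := by
    rcases (Metric.sphere θ r).eq_empty_or_nonempty with he | he
    · refine ⟨1, one_pos, fun θ' _ h' => ?_⟩
      have : θ' ∈ Metric.sphere θ r := by simpa [dist_eq_norm] using h'
      simp [he] at this
    · obtain ⟨s, hsr, hmin⟩ := LowerSemicontinuousOn.exists_isMinOn he (isCompact_sphere θ r)
        ((lowerSemicontinuous_tilt (P := P) y).lowerSemicontinuousOn _)
      by_cases hsm : s ∈ naturalSpace P
      · refine ⟨logZ P s - logZ P θ - inner ℝ y (s - θ), ?_, fun θ' hθ' h' => ?_⟩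
        · have hsθ : s ≠ θ := by
            rintro rfl
            simp at hsr
            exact hr.ne hsr
          have := h.lt hs hne hsm hsθ
          linarith
        · have := (tilt_le_tilt_iff hsm hθ').1
            (hmin (show θ' ∈ Metric.sphere θ r by simpa [dist_eq_norm] using h'))
          rw [inner_sub_right, inner_sub_right]
          linarith
      · refine ⟨1, one_pos, fun θ' hθ' h' => absurd ?_ hsm⟩
        exact mem_naturalSpace_of_tilt_le hθ'
          (hmin (show θ' ∈ Metric.sphere θ r by simpa [dist_eq_norm] using h'))
  refine ⟨k / r, by positivity, fun θ' hθ' hle => ?_⟩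
  set ρ := ‖θ' - θ‖ with hρ
  have hρ0 : 0 < ρ := hr.trans_le hle
  have hs01 : r / ρ ∈ Icc (0 : ℝ) 1 := ⟨by positivity, (div_le_one hρ0).2 hle⟩
  -- Pull `θ'` back to the sphere of radius `r`; by convexity the excess at `θ'` is at least `ρ / r`
  -- times the excess there.
  have hw : θ + (r / ρ) • (θ' - θ) ∈ naturalSpace P :=
    (convexOn_logZ (P := P)).1.add_smul_sub_mem h.1 hθ' hs01
  have h1 := hsph _ hw (by
    rw [add_sub_cancel_left, norm_smul, Real.norm_of_nonneg hs01.1, ← hρ]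
    field_simp)
  have h2 := (convexOn_logZ (P := P)).2 h.1 hθ' (sub_nonneg.2 hs01.2) hs01.1 (by ring)
  have e : (1 - r / ρ) • θ + (r / ρ) • θ' = θ + (r / ρ) • (θ' - θ) := by module
  rw [e] at h2
  rw [add_sub_cancel_left, inner_smul_right] at h1
  simp only [smul_eq_mul] at h2
  have h3 : k ≤ r / ρ * (logZ P θ' - logZ P θ - inner ℝ y (θ' - θ)) := by linarith
  have h4 : k * ρ ≤ r * (logZ P θ' - logZ P θ - inner ℝ y (θ' - θ)) := by
    rw [div_mul_eq_mul_div, le_div_iff₀ hρ0] at h3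
    exact h3
  have h5 : k / r * ρ ≤ logZ P θ' - logZ P θ - inner ℝ y (θ' - θ) := by
    rw [div_mul_eq_mul_div, div_le_iff₀ hr]
    linarith
  linarith

lemma IsSubgradient.isBounded_sublevel [NeZero P] (hs : Steep P)
    (hne : (interior (convexSupport Ω P)).Nonempty) {y θ : EuclideanSpace ℝ (Fin d)}
    (h : IsSubgradient P y θ) (M : ℝ) :
    Bornology.IsBounded {θ' | θ' ∈ naturalSpace P ∧ logZ P θ' - inner ℝ y θ' ≤ M} := by
  obtain ⟨c, hc, hgr⟩ := h.exists_growth hs hne one_pos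
  refine (Metric.isBounded_iff_subset_closedBall θ).2
    ⟨max 1 ((M - logZ P θ + inner ℝ y θ) / c), fun θ' hθ' => ?_⟩
  rw [Metric.mem_closedBall, dist_eq_norm, le_max_iff]
  rcases le_total ‖θ' - θ‖ 1 with h1 | h1
  · exact Or.inl h1
  · right
    have := hgr θ' hθ'.1 h1
    have h2 := hθ'.2
    rw [inner_sub_right] at this
    rw [le_div_iff₀ hc]
    linarith

lemma exists_isSubgradient_of_isBounded [NeZero P] {y θ₀ : EuclideanSpace ℝ (Fin d)}
    (hθ₀ : θ₀ ∈ naturalSpace P)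
    (hb : Bornology.IsBounded
      {θ | θ ∈ naturalSpace P ∧ logZ P θ - inner ℝ y θ ≤ logZ P θ₀ - inner ℝ y θ₀}) :
    ∃ θ, IsSubgradient P y θ := by
  obtain ⟨θ, -, hθ⟩ := exists_mem_argmin (lowerSemicontinuous_tilt (P := P) y) isClosed_univ
    (mem_univ θ₀) (hb.subset fun θ hθ => ⟨mem_naturalSpace_of_tilt_le hθ₀ hθ,
      (tilt_le_tilt_iff (mem_naturalSpace_of_tilt_le hθ₀ hθ) hθ₀).1 hθ⟩)
  have hmem := mem_naturalSpace_of_tilt_le hθ₀ (hθ θ₀ (mem_univ _))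
  refine ⟨θ, hmem, fun θ' hθ' => ?_⟩
  have := (tilt_le_tilt_iff hmem hθ').1 (hθ θ' (mem_univ _))
  rw [inner_sub_right]
  linarith

end Steepness

/-! ### The conjugate: domain, differentiability, inversion of gradients -/

section Conjugate

variable {d : ℕ} {P : Measure (EuclideanSpace ℝ (Fin d))} {Ω : Set (EuclideanSpace ℝ (Fin d))}

/-- Uniform boundedness principle: the bounds for `v` and `-v` make the functionals `⟨θ, ·⟩`
pointwise bounded. -/
lemma isBounded_of_forall_inner_le {B : Set (EuclideanSpace ℝ (Fin d))}
    (hdir : ∀ v : EuclideanSpace ℝ (Fin d), ∃ C : ℝ, ∀ θ ∈ B, inner ℝ v θ ≤ C) :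
    Bornology.IsBounded B := by
  obtain ⟨C, hC⟩ := banach_steinhaus (g := fun θ : B => innerSL ℝ (θ : EuclideanSpace ℝ (Fin d)))
    (fun v => by
      obtain ⟨C₁, h₁⟩ := hdir v
      obtain ⟨C₂, h₂⟩ := hdir (-v)
      refine ⟨max C₁ C₂, fun θ => ?_⟩
      have e1 := h₁ θ θ.2
      have e2 := h₂ θ θ.2
      rw [inner_neg_left] at e2
      rw [innerSL_apply_apply, real_inner_comm, Real.norm_eq_abs, abs_le]
      exact ⟨by linarith [le_max_right C₁ C₂], e1.trans (le_max_left _ _)⟩)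
  refine isBounded_iff_forall_norm_le.2 ⟨C, fun θ hθ => ?_⟩
  simpa using hC ⟨θ, hθ⟩

lemma conj_le_iff [NeZero P] {y : EuclideanSpace ℝ (Fin d)} {M : ℝ} :
    conj (logNormalizer P) y ≤ (M : EReal) ↔
      ∀ θ ∈ naturalSpace P, inner ℝ y θ - logZ P θ ≤ M := by
  rw [conj, iSup_le_iff]
  refine forall_congr' fun θ => ?_
  by_cases hθ : θ ∈ naturalSpace P
  · rw [coe_logZ hθ, ← EReal.coe_sub, EReal.coe_le_coe_iff]
    simp [hθ]
  · simp [logNormalizer_of_notMem hθ, hθ]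

lemma mem_dom_conj_iff [NeZero P] {y : EuclideanSpace ℝ (Fin d)} :
    y ∈ dom (conj (logNormalizer P)) ↔
      ∃ M : ℝ, ∀ θ ∈ naturalSpace P, inner ℝ y θ - logZ P θ ≤ M := by
  simp_rw [← conj_le_iff]
  constructor
  · intro h
    obtain ⟨M, hM, -⟩ := EReal.lt_iff_exists_real_btwn.1 (show conj (logNormalizer P) y < ⊤ from h)
    exact ⟨M, hM.le⟩
  · rintro ⟨M, hM⟩
    exact hM.trans_lt (EReal.coe_lt_top M)

lemma le_conj [NeZero P] {y θ : EuclideanSpace ℝ (Fin d)} (hθ : θ ∈ naturalSpace P) :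
    ((inner ℝ y θ - logZ P θ : ℝ) : EReal) ≤ conj (logNormalizer P) y := by
  rw [EReal.coe_sub, ← coe_logZ hθ]
  exact le_iSup (fun x => ((inner ℝ y x : ℝ) : EReal) - logNormalizer P x) θ

lemma conj_ne_bot [NeZero P] {θ : EuclideanSpace ℝ (Fin d)} (hθ : θ ∈ naturalSpace P)
    (y : EuclideanSpace ℝ (Fin d)) : conj (logNormalizer P) y ≠ ⊥ :=
  ((EReal.bot_lt_coe _).trans_le (le_conj hθ)).ne'

lemma IsSubgradient.conj_eq [NeZero P] {y θ : EuclideanSpace ℝ (Fin d)}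
    (h : IsSubgradient P y θ) :
    conj (logNormalizer P) y = ((inner ℝ y θ - logZ P θ : ℝ) : EReal) := by
  refine le_antisymm (conj_le_iff.2 fun θ' hθ' => ?_) (le_conj h.1)
  have := h.2 θ' hθ'
  rw [inner_sub_right] at this
  linarith

lemma isSubgradient_of_conj_le [NeZero P] {y θ : EuclideanSpace ℝ (Fin d)}
    (hθ : θ ∈ naturalSpace P)
    (h : conj (logNormalizer P) y ≤ ((inner ℝ y θ - logZ P θ : ℝ) : EReal)) :
    IsSubgradient P y θ := by
  refine ⟨hθ, fun θ' hθ' => ?_⟩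
  have := conj_le_iff.1 h θ' hθ'
  rw [inner_sub_right]
  linarith

lemma coe_toReal_conj [NeZero P] {θ y : EuclideanSpace ℝ (Fin d)} (hθ : θ ∈ naturalSpace P)
    (hy : y ∈ dom (conj (logNormalizer P))) :
    ((conj (logNormalizer P) y).toReal : EReal) = conj (logNormalizer P) y :=
  EReal.coe_toReal (ne_of_lt hy) (conj_ne_bot hθ y)

lemma conj_expFamily [NeZero P] {l : EuclideanSpace ℝ (Fin d)}
    (y : EuclideanSpace ℝ (Fin d)) :
    conj (logNormalizer (expFamily P l)) y =
      conj (logNormalizer P) y + ((logZ P l - inner ℝ y l : ℝ) : EReal) := by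
  have := neZero_expFamily (P := P) l
  -- Comparing real upper bounds reduces the identity to `conj_le_iff` and the shift `θ = l + η`,
  -- with no case split on infinite values.
  have key : ∀ M : ℝ, conj (logNormalizer (expFamily P l)) y ≤ M ↔
      conj (logNormalizer P) y + ((logZ P l - inner ℝ y l : ℝ) : EReal) ≤ M := by
    intro M
    rw [← EReal.le_sub_iff_add_le (Or.inl (EReal.coe_ne_bot _)) (Or.inl (EReal.coe_ne_top _)),
      ← EReal.coe_sub, conj_le_iff, conj_le_iff]
    constructor
    · intro h θ hθ
      have hm : l + (θ - l) ∈ naturalSpace P := by simpa using hθ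
      have := h (θ - l) (mem_naturalSpace_expFamily.2 hm)
      rw [logZ_expFamily hm, add_sub_cancel, inner_sub_right] at this
      linarith
    · intro h η hη
      have hm := mem_naturalSpace_expFamily.1 hη
      have := h _ hm
      rw [inner_add_right] at this
      rw [logZ_expFamily hm]
      linarith
  refine le_antisymm ?_ ?_
  · exact EReal.le_of_forall_lt_iff_le.1 fun z hz => (key z).2 hz.le
  · exact EReal.le_of_forall_lt_iff_le.1 fun z hz => (key z).1 hz.le

lemma convex_dom_conj [NeZero P] : Convex ℝ (dom (conj (logNormalizer P))) := by
  intro y₁ h₁ y₂ h₂ a b ha hb hab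
  rw [mem_dom_conj_iff] at *
  obtain ⟨M₁, hM₁⟩ := h₁
  obtain ⟨M₂, hM₂⟩ := h₂
  refine ⟨a * M₁ + b * M₂, fun θ hθ => ?_⟩
  have e1 := mul_le_mul_of_nonneg_left (hM₁ θ hθ) ha
  have e2 := mul_le_mul_of_nonneg_left (hM₂ θ hθ) hb
  have e3 : logZ P θ = a * logZ P θ + b * logZ P θ := by rw [← add_mul, hab, one_mul]
  rw [inner_add_left, real_inner_smul_left, real_inner_smul_left]
  linarith

/-- Far from `θ`, the growth rate `c` beats any perturbation with `‖y' - y‖ < c`; within distance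
`r`, Cauchy–Schwarz costs at most `r * ‖y' - y‖`. The matching lower bound is Fenchel–Young at `θ`,
so this one estimate yields both interiority and differentiability. -/
lemma IsSubgradient.conj_le_of_near [NeZero P] (hs : Steep P)
    (hne : (interior (convexSupport Ω P)).Nonempty) {y θ : EuclideanSpace ℝ (Fin d)}
    (h : IsSubgradient P y θ) {r : ℝ} (hr : 0 < r) :
    ∀ᶠ y' in 𝓝 y, conj (logNormalizer P) y' ≤
      ((inner ℝ y θ - logZ P θ + inner ℝ θ (y' - y) + r * ‖y' - y‖ : ℝ) : EReal) := by
  obtain ⟨c, hc, hgr⟩ := h.exists_growth hs hne hr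
  filter_upwards [Metric.ball_mem_nhds y hc] with y' hy'
  rw [Metric.mem_ball, dist_eq_norm] at hy'
  rw [conj_le_iff]
  intro θ' hθ'
  have hcs := real_inner_le_norm (y' - y) (θ' - θ)
  have e : inner ℝ y' θ' = inner ℝ y θ + inner ℝ y (θ' - θ) + inner ℝ θ (y' - y) +
      inner ℝ (y' - y) (θ' - θ) := by
    simp only [inner_sub_left, inner_sub_right]
    rw [real_inner_comm y' θ, real_inner_comm y θ]
    ring
  rcases le_total r ‖θ' - θ‖ with hle | hle
  · have h1 := hgr θ' hθ' hle
    have h2 : ‖y' - y‖ * ‖θ' - θ‖ ≤ c * ‖θ' - θ‖ := by gcongr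
    have h3 : 0 ≤ r * ‖y' - y‖ := by positivity
    linarith
  · have h1 := h.2 θ' hθ'
    have h2 : ‖y' - y‖ * ‖θ' - θ‖ ≤ ‖y' - y‖ * r := by gcongr
    linarith

lemma IsSubgradient.mem_interior_dom_conj [NeZero P] (hs : Steep P)
    (hne : (interior (convexSupport Ω P)).Nonempty) {y θ : EuclideanSpace ℝ (Fin d)}
    (h : IsSubgradient P y θ) : y ∈ interior (dom (conj (logNormalizer P))) := by
  rw [mem_interior_iff_mem_nhds]
  filter_upwards [h.conj_le_of_near hs hne one_pos] with y' hy'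
  exact hy'.trans_lt (EReal.coe_lt_top _)

lemma IsSubgradient.hasGradientAt_conj [NeZero P] (hs : Steep P)
    (hne : (interior (convexSupport Ω P)).Nonempty) {y θ : EuclideanSpace ℝ (Fin d)}
    (h : IsSubgradient P y θ) :
    HasGradientAt (fun y => (conj (logNormalizer P) y).toReal) θ y := by
  rw [hasGradientAt_iff_isLittleO, Asymptotics.isLittleO_iff]
  intro r hr
  filter_upwards [h.conj_le_of_near hs hne hr] with y' hy'
  have h1 := coe_toReal_conj h.1 (y := y') (hy'.trans_lt (EReal.coe_lt_top _))
  have h2 := le_conj (y := y') h.1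
  rw [← h1, EReal.coe_le_coe_iff] at hy' h2
  rw [h.conj_eq, EReal.toReal_coe, Real.norm_eq_abs, abs_le]
  have h3 : 0 ≤ r * ‖y' - y‖ := by positivity
  rw [inner_sub_right, real_inner_comm y' θ, real_inner_comm y θ] at *
  constructor <;> linarith

lemma IsSubgradient.grad_conj_eq [NeZero P] (hs : Steep P)
    (hne : (interior (convexSupport Ω P)).Nonempty) {y θ : EuclideanSpace ℝ (Fin d)}
    (h : IsSubgradient P y θ) : grad (conj (logNormalizer P)) y = θ :=
  (h.hasGradientAt_conj hs hne).gradient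

/-- Finiteness of `ψ_P*` at `y + (ε / 2) • v` bounds `⟨v, θ⟩` on a sublevel set of `ψ_P - ⟨y, ·⟩`.
All directions together make this set bounded, so a minimizer exists. -/
lemma exists_isSubgradient_of_mem_interior_dom_conj [NeZero P] (hs : Steep P)
    {y : EuclideanSpace ℝ (Fin d)} (hy : y ∈ interior (dom (conj (logNormalizer P)))) :
    ∃ θ, IsSubgradient P y θ := by
  obtain ⟨θ₀, hθ₀⟩ := hs.1
  rw [dom_logNormalizer] at hθ₀
  refine exists_isSubgradient_of_isBounded (interior_subset hθ₀)
    (isBounded_of_forall_inner_le fun v => ?_)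
  have hev : ∀ᶠ t : ℝ in 𝓝 0, y + t • v ∈ dom (conj (logNormalizer P)) := by
    have hcont : ContinuousAt (fun t : ℝ => y + t • v) 0 := by fun_prop
    exact hcont.eventually_mem (by simpa using mem_interior_iff_mem_nhds.1 hy)
  obtain ⟨ε, hε, hb⟩ := Metric.eventually_nhds_iff.1 hev
  obtain ⟨M, hM⟩ := mem_dom_conj_iff.1 (hb (y := ε / 2) (by simp [abs_of_pos hε]; linarith))
  refine ⟨(M + (logZ P θ₀ - inner ℝ y θ₀)) / (ε / 2), fun θ hθ => ?_⟩
  have h1 := hM θ hθ.1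
  have h2 := hθ.2
  rw [inner_add_left, real_inner_smul_left] at h1
  rw [le_div_iff₀ (half_pos hε)]
  linarith

lemma exists_isSubgradient_of_mem_interior_convexSupport [NeZero P] (hs : Steep P)
    {y : EuclideanSpace ℝ (Fin d)} (hy : y ∈ interior (convexSupport Ω P)) :
    ∃ θ, IsSubgradient P y θ := by
  obtain ⟨θ₀, hθ₀⟩ := hs.1
  rw [dom_logNormalizer] at hθ₀
  refine exists_isSubgradient_of_isBounded (interior_subset hθ₀) ?_
  -- `m v` is the integral of the positive part of `⟨x - y, v⟩`. It is positive for `v ≠ 0` because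
  -- `y` is interior to the convex support, hence at least some `δ > 0` on the unit sphere. By
  -- homogeneity and `s ≤ exp s`, `tilt P y θ ≥ δ * ‖θ‖`, so sublevel sets are bounded.
  let m : EuclideanSpace ℝ (Fin d) → ENNReal := fun v =>
    ∫⁻ x, ENNReal.ofReal (inner ℝ x v - inner ℝ y v) ∂P
  have hm : LowerSemicontinuous m := by
    refine lowerSemicontinuous_lintegral (fun θ => by fun_prop) fun x => ?_
    exact ENNReal.continuous_ofReal.comp (by fun_prop)
  have hpos : ∀ v ≠ 0, 0 < m v := by
    intro v hv
    rw [pos_iff_ne_zero]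
    intro h0
    rw [lintegral_eq_zero_iff (by fun_prop)] at h0
    refine not_ae_inner_le hy hv le_rfl ?_
    filter_upwards [h0] with x hx
    simpa using hx
  obtain ⟨δ, hδ, hδm⟩ : ∃ δ : ℝ, 0 < δ ∧
      ∀ v ∈ Metric.sphere (0 : EuclideanSpace ℝ (Fin d)) 1, ENNReal.ofReal δ ≤ m v := by
    rcases (Metric.sphere (0 : EuclideanSpace ℝ (Fin d)) 1).eq_empty_or_nonempty with he | he
    · exact ⟨1, one_pos, fun v hv => by simp [he] at hv⟩
    · obtain ⟨s, hs1, hmin⟩ := LowerSemicontinuousOn.exists_isMinOn he (isCompact_sphere _ _)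
        (hm.lowerSemicontinuousOn _)
      have hs0 : 0 < m s := hpos s (by rintro rfl; simp at hs1)
      obtain ⟨q, hq0, hqs⟩ := ENNReal.lt_iff_exists_real_btwn.1 hs0
      refine ⟨q, ?_, fun v hv => hqs.2.le.trans (hmin hv)⟩
      simpa using hqs.1
  refine isBounded_iff_forall_norm_le.2
    ⟨Real.exp (logZ P θ₀ - inner ℝ y θ₀) / δ, fun θ hθ => ?_⟩
  rcases eq_or_ne θ 0 with rfl | hne
  · rw [norm_zero]; positivity
  have hn : 0 < ‖θ‖ := norm_pos_iff.2 hne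
  have h1 : ENNReal.ofReal (‖θ‖ * δ) ≤ tilt P y θ := by
    calc ENNReal.ofReal (‖θ‖ * δ) = ENNReal.ofReal ‖θ‖ * ENNReal.ofReal δ :=
          ENNReal.ofReal_mul hn.le
      _ ≤ ENNReal.ofReal ‖θ‖ * m (‖θ‖⁻¹ • θ) := by
          gcongr
          refine hδm _ ?_
          rw [mem_sphere_zero_iff_norm, norm_smul, norm_inv, norm_norm, inv_mul_cancel₀ hn.ne']
      _ = ∫⁻ x, ENNReal.ofReal (inner ℝ x θ - inner ℝ y θ) ∂P := by
          rw [← lintegral_const_mul _ (by fun_prop)]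
          congr 1; ext x
          rw [← ENNReal.ofReal_mul hn.le, inner_smul_right, inner_smul_right]
          congr 1
          field_simp
      _ ≤ tilt P y θ := by
          refine lintegral_mono fun x => ENNReal.ofReal_le_ofReal ?_
          linarith [Real.add_one_le_exp (inner ℝ x θ - inner ℝ y θ)]
  rw [tilt_eq hθ.1, ENNReal.ofReal_le_ofReal_iff (Real.exp_pos _).le] at h1
  rw [le_div_iff₀ hδ]
  exact h1.trans (Real.exp_le_exp.2 hθ.2)

lemma isSubgradient_grad_conj [NeZero P] (hs : Steep P)
    (hne : (interior (convexSupport Ω P)).Nonempty) {y : EuclideanSpace ℝ (Fin d)}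
    (hy : y ∈ interior (dom (conj (logNormalizer P)))) :
    IsSubgradient P y (grad (conj (logNormalizer P)) y) := by
  obtain ⟨θ, hθ⟩ := exists_isSubgradient_of_mem_interior_dom_conj hs hy
  rwa [hθ.grad_conj_eq hs hne]

end Conjugate

/-! ### Estimators, Bregman distances and divergences -/

section Estimators

variable {d : ℕ} {P : Measure (EuclideanSpace ℝ (Fin d))} {Ω : Set (EuclideanSpace ℝ (Fin d))}

/-- A finite divergence makes `⟨x, θ₀ - θ⟩` integrable under `P_θ`, and Jensen along the segment to
`θ₀` then bounds the slope below, as `Steep.mem_interior` requires. The full mean of `P_θ` need not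
exist beforehand. -/
lemma mem_interior_of_klDiv_ne_top [NeZero P] (hs : Steep P) {θ θ₀ : EuclideanSpace ℝ (Fin d)}
    (hθ : θ ∈ naturalSpace P) (hθ₀ : θ₀ ∈ interior (naturalSpace P))
    (h : klDiv (expFamily P θ) (expFamily P θ₀) ≠ ⊤) : θ ∈ interior (naturalSpace P) := by
  have hi := (integrable_inner_of_klDiv_ne_top hθ (interior_subset hθ₀) h).neg
  have hi' : Integrable (fun x => (inner ℝ x (θ₀ - θ) : ℝ)) (expFamily P θ) := by
    refine hi.congr (ae_of_all _ fun x => ?_)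
    simp [inner_sub_right]
  refine hs.mem_interior hθ hθ₀ (a := ∫ x, (inner ℝ x (θ₀ - θ) : ℝ) ∂(expFamily P θ))
    fun t ht => ?_
  have hmem : θ + t • (θ₀ - θ) ∈ naturalSpace P :=
    (convexOn_logZ (P := P)).1.add_smul_sub_mem hθ (interior_subset hθ₀) ⟨ht.1.le, ht.2⟩
  have := logZ_add_integral_le hθ hmem (by
    simpa only [add_sub_cancel_left, inner_smul_right] using hi'.const_mul t)
  simpa only [add_sub_cancel_left, inner_smul_right, integral_const_mul] using this

lemma isBounded_sublevel_conj {Q : Measure (EuclideanSpace ℝ (Fin d))} [NeZero Q]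
    (h : (0 : EuclideanSpace ℝ (Fin d)) ∈ interior (naturalSpace Q)) (c : ℝ) :
    Bornology.IsBounded {y | conj (logNormalizer Q) y ≤ (c : EReal)} := by
  refine isBounded_of_forall_inner_le fun v => ?_
  have hev : ∀ᶠ t : ℝ in 𝓝 0, t • v ∈ naturalSpace Q := by
    have hcont : ContinuousAt (fun t : ℝ => t • v) 0 := by fun_prop
    exact hcont.eventually_mem (by simpa using mem_interior_iff_mem_nhds.1 h)
  obtain ⟨ε, hε, hb⟩ := Metric.eventually_nhds_iff.1 hev
  have hmem := hb (y := ε / 2) (by simp [abs_of_pos hε]; linarith)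
  refine ⟨(c + logZ Q ((ε / 2) • v)) / (ε / 2), fun y hy => ?_⟩
  have := conj_le_iff.1 hy _ hmem
  rw [inner_smul_right] at this
  rw [le_div_iff₀ (half_pos hε), real_inner_comm]
  linarith

lemma argmin_conj_expFamily_nonempty [NeZero P] {θ : EuclideanSpace ℝ (Fin d)}
    (hθ : θ ∈ interior (naturalSpace P)) {T : Set (EuclideanSpace ℝ (Fin d))} (hT : IsClosed T)
    (hne : (T ∩ dom (conj (logNormalizer P))).Nonempty) :
    (argmin (conj (logNormalizer (expFamily P θ))) T).Nonempty := by
  obtain ⟨y₀, hy₀, hy₀d⟩ := hne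
  have := neZero_expFamily (P := P) θ
  refine exists_mem_argmin (lowerSemicontinuous_conj _) hT hy₀ ?_
  rw [conj_expFamily, ← coe_toReal_conj (interior_subset hθ) hy₀d, ← EReal.coe_add]
  exact isBounded_sublevel_conj (zero_mem_interior_naturalSpace_expFamily hθ) _

/-- A reference parameter `l` whose mean is `y` has `y` as subgradient, hence equals `∇ψ_P*(y) = θ`;
the choice of reference in the definition is therefore forced. -/
lemma memEstimators_eq [NeZero P] (hs : Steep P) (hne : (interior (convexSupport Ω P)).Nonempty)
    {y θ : EuclideanSpace ℝ (Fin d)} (h : IsSubgradient P y θ)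
    (T : Set (EuclideanSpace ℝ (Fin d))) :
    memEstimators y (naturalSpace P) (expFamily P) T =
      argmin (conj (logNormalizer (expFamily P θ))) T := by
  ext z
  constructor
  · rintro ⟨l, hl, hi, hm, hz⟩
    have hsub := isSubgradient_integral hl hi
    rw [hm] at hsub
    rwa [← h.grad_conj_eq hs hne, hsub.grad_conj_eq hs hne]
  · intro hz
    have hint := h.mem_interior hs
    refine ⟨θ, h.1, integrable_expFamily_of_mem_interior hint, ?_, hz⟩
    rw [integral_expFamily_eq_grad hs hint, h.grad_eq hs hint]

lemma bregman_conj_eq [NeZero P] (hs : Steep P) (hne : (interior (convexSupport Ω P)).Nonempty)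
    {y θ : EuclideanSpace ℝ (Fin d)} (h : IsSubgradient P y θ) :
    (fun z => bregman (conj (logNormalizer P)) z y) =
      conj (logNormalizer (expFamily P θ)) := by
  ext z
  rw [bregman, h.conj_eq, h.grad_conj_eq hs hne, conj_expFamily, sub_eq_add_neg, sub_eq_add_neg,
    add_assoc, ← EReal.coe_neg, ← EReal.coe_neg, ← EReal.coe_add]
  congr 2
  rw [inner_sub_right, real_inner_comm z θ, real_inner_comm y θ]
  ring

/-- The mean of `P_θ` is `y`, so by Fenchel equality both sides are `ψ_P(θ₀) - ψ_P(θ) - ⟨y, θ₀ -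
θ⟩`. This identity carries the primal analogy. -/
lemma coe_klDiv_expFamily [NeZero P] (hs : Steep P) {y θ θ₀ : EuclideanSpace ℝ (Fin d)}
    (h : IsSubgradient P y θ) (hθ₀ : θ₀ ∈ naturalSpace P) :
    ((klDiv (expFamily P θ) (expFamily P θ₀) : ENNReal) : EReal) =
      conj (logNormalizer (expFamily P θ₀)) y := by
  have hint := h.mem_interior hs
  rw [klDiv_expFamily h.1 hθ₀ (integrable_expFamily_of_mem_interior hint),
    integral_expFamily_eq_grad hs hint, h.grad_eq hs hint, conj_expFamily, h.conj_eq,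
    ← EReal.coe_add, EReal.coe_ennreal_ofReal, max_eq_left]
  · congr 1
    rw [inner_sub_right]
    ring
  · linarith [h.2 θ₀ hθ₀]

lemma klDiv_le_klDiv_iff [NeZero P] (hs : Steep P) {y z θ η θ₀ : EuclideanSpace ℝ (Fin d)}
    (h : IsSubgradient P y θ) (h' : IsSubgradient P z η) (hθ₀ : θ₀ ∈ naturalSpace P) :
    klDiv (expFamily P θ) (expFamily P θ₀) ≤ klDiv (expFamily P η) (expFamily P θ₀) ↔
      conj (logNormalizer (expFamily P θ₀)) y ≤ conj (logNormalizer (expFamily P θ₀)) z := by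
  rw [← coe_klDiv_expFamily hs h hθ₀, ← coe_klDiv_expFamily hs h' hθ₀,
    EReal.coe_ennreal_le_coe_ennreal_iff]

/-- Minimizers of the rate function over a convex set meeting the interior of its domain are
interior points of the domain. -/
lemma mem_interior_of_mem_argmin [NeZero P] (hs : Steep P)
    (hne : (interior (convexSupport Ω P)).Nonempty) (η : EuclideanSpace ℝ (Fin d))
    {T : Set (EuclideanSpace ℝ (Fin d))} (hT : Convex ℝ T) {y₀ y₁ : EuclideanSpace ℝ (Fin d)}
    (hy₀ : y₀ ∈ T) (hy₀i : y₀ ∈ interior (dom (conj (logNormalizer P))))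
    (hy₁ : y₁ ∈ argmin (conj (logNormalizer (expFamily P η))) T) :
    y₁ ∈ interior (dom (conj (logNormalizer P))) := by
  obtain ⟨θ₀, hθ₀⟩ := exists_isSubgradient_of_mem_interior_dom_conj hs hy₀i
  have hmin : ∀ z ∈ T, ∀ θ, IsSubgradient P z θ → conj (logNormalizer P) y₁ ≤
      ((inner ℝ z θ - logZ P θ + inner ℝ (y₁ - z) η : ℝ) : EReal) := by
    intro z hz θ hθ
    have h := hy₁.2 z hz
    rw [conj_expFamily, conj_expFamily, hθ.conj_eq, ← EReal.coe_add,
      ← EReal.le_sub_iff_add_le (Or.inl (EReal.coe_ne_bot _)) (Or.inl (EReal.coe_ne_top _)),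
      ← EReal.coe_sub] at h
    refine h.trans (EReal.coe_le_coe_iff.2 (le_of_eq ?_))
    rw [inner_sub_left]
    ring
  have hy₁d : y₁ ∈ dom (conj (logNormalizer P)) :=
    (hmin y₀ hy₀ θ₀ hθ₀).trans_lt (EReal.coe_lt_top _)
  have hR := coe_toReal_conj hθ₀.1 hy₁d
  set R := (conj (logNormalizer P) y₁).toReal
  let t : ℕ → ℝ := fun n => 1 / ((n : ℝ) + 1)
  have ht : ∀ n, 0 < t n ∧ t n ≤ 1 := fun n =>
    ⟨by positivity, by
      rw [div_le_one (by positivity)]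
      have : (0 : ℝ) ≤ n := n.cast_nonneg
      linarith⟩
  have ht0 : Tendsto t atTop (𝓝 0) := tendsto_one_div_add_atTop_nhds_zero_nat
  let u : ℕ → EuclideanSpace ℝ (Fin d) := fun n => y₁ + t n • (y₀ - y₁)
  have huT : ∀ n, u n ∈ T := fun n => hT.add_smul_sub_mem hy₁.1 hy₀ ⟨(ht n).1.le, (ht n).2⟩
  have hui : ∀ n, u n ∈ interior (dom (conj (logNormalizer P))) := fun n => by
    have := (convex_dom_conj (P := P)).combo_interior_self_mem_interior hy₀i hy₁d (ht n).1
      (sub_nonneg.2 (ht n).2) (by ring)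
    convert this using 1
    simp only [u]
    module
  choose θ hθ using fun n => exists_isSubgradient_of_mem_interior_dom_conj hs (hui n)
  have h1 : ∀ n, R ≤ inner ℝ y₁ (θ n) + t n * inner ℝ (y₀ - y₁) (θ n) - logZ P (θ n)
      - t n * inner ℝ (y₀ - y₁) η := by
    intro n
    have h := hmin _ (huT n) _ (hθ n)
    rw [← hR, EReal.coe_le_coe_iff] at h
    have e : y₁ - u n = -(t n • (y₀ - y₁)) := by simp [u]
    rw [e, inner_neg_left, real_inner_smul_left] at h
    simp only [u, inner_add_left, real_inner_smul_left] at h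
    linarith
  have h2 : ∀ n, inner ℝ y₁ (θ n) - logZ P (θ n) ≤ R := by
    intro n
    have h := le_conj (y := y₁) (hθ n).1
    rwa [← hR, EReal.coe_le_coe_iff] at h
  -- Minimality of `y₁` against `u n`, combined with Fenchel–Young at `y₁`, bounds the subgradients
  -- `θ n` from below in the direction `y₀ - y₁`.
  have h3 : ∀ n, inner ℝ (y₀ - y₁) η ≤ inner ℝ (y₀ - y₁) (θ n) := by
    intro n
    have : t n * inner ℝ (y₀ - y₁) η ≤ t n * inner ℝ (y₀ - y₁) (θ n) := by
      linarith [h1 n, h2 n]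
    exact le_of_mul_le_mul_left this (ht n).1
  -- With `h3` the parameters `θ n` lie in one sublevel set of `ψ_P - ⟨y₀, ·⟩`, which is bounded
  -- because `y₀` has a subgradient.
  have hbd : ∀ n, θ n ∈ {θ' | θ' ∈ naturalSpace P ∧
      logZ P θ' - inner ℝ y₀ θ' ≤ -inner ℝ (y₀ - y₁) η - R} := by
    intro n
    refine ⟨(hθ n).1, ?_⟩
    have := mul_le_mul_of_nonneg_left (h3 n) (sub_nonneg.2 (ht n).2)
    have := h1 n
    have e : inner ℝ (y₀ - y₁) (θ n) = inner ℝ y₀ (θ n) - inner ℝ y₁ (θ n) := inner_sub_left _ _ _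
    linarith
  obtain ⟨θ', -, φ, hφ, hlim⟩ :=
    tendsto_subseq_of_bounded (hθ₀.isBounded_sublevel hs hne _) hbd
  have htφ : Tendsto (fun n => t (φ n)) atTop (𝓝 0) := ht0.comp hφ.tendsto_atTop
  -- Semicontinuity passes `h1` to the limit, the terms with factor `t (φ n)` vanishing along the
  -- convergent subsequence. The limit `θ'` thus attains Fenchel equality at `y₁`, so it is a
  -- subgradient partner of `y₁`.
  have hle : tilt P y₁ θ' ≤ ENNReal.ofReal (Real.exp (-R)) := by
    refine le_of_forall_lt_imp_le_of_dense fun a ha => ?_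
    have htend : Tendsto (fun n => ENNReal.ofReal (Real.exp
        (t (φ n) * (inner ℝ (y₀ - y₁) ((θ ∘ φ) n) - inner ℝ (y₀ - y₁) η) - R))) atTop
        (𝓝 (ENNReal.ofReal (Real.exp (-R)))) := by
      refine (ENNReal.continuous_ofReal.comp Real.continuous_exp).continuousAt.tendsto.comp ?_
      have := (htφ.mul (((tendsto_const_nhds (x := y₀ - y₁)).inner (𝕜 := ℝ) hlim).sub_const
        (inner ℝ (y₀ - y₁) η))).sub_const R
      simpa using this
    refine ge_of_tendsto htend ?_
    filter_upwards [hlim.eventually (lowerSemicontinuous_tilt (P := P) y₁ θ' a ha)] with n hn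
    refine hn.le.trans ?_
    rw [Function.comp_apply, tilt_eq (hθ (φ n)).1]
    refine ENNReal.ofReal_le_ofReal (Real.exp_le_exp.2 ?_)
    linarith [h1 (φ n)]
  have hmem : θ' ∈ naturalSpace P :=
    (lintegral_exp_sub_lt_top_iff _).1 (hle.trans_lt ENNReal.ofReal_lt_top)
  rw [tilt_eq hmem, ENNReal.ofReal_le_ofReal_iff (Real.exp_pos _).le, Real.exp_le_exp] at hle
  refine (isSubgradient_of_conj_le hmem ?_).mem_interior_dom_conj hs hne
  rw [← hR, EReal.coe_le_coe_iff]
  linarith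

/-- Uniqueness of minimizers of the rate function over a convex set, in the interior of its
domain. -/
lemma eq_of_mem_argmin [NeZero P] (hs : Steep P) {η : EuclideanSpace ℝ (Fin d)}
    {T : Set (EuclideanSpace ℝ (Fin d))} (hT : Convex ℝ T) {y₁ y₂ : EuclideanSpace ℝ (Fin d)}
    (hy₁ : y₁ ∈ argmin (conj (logNormalizer (expFamily P η))) T)
    (hy₂ : y₂ ∈ argmin (conj (logNormalizer (expFamily P η))) T)
    (hi₁ : y₁ ∈ interior (dom (conj (logNormalizer P))))
    (hi₂ : y₂ ∈ interior (dom (conj (logNormalizer P)))) : y₁ = y₂ := by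
  set y := (1 / 2 : ℝ) • y₁ + (1 / 2 : ℝ) • y₂ with hy
  have hyT : y ∈ T := hT hy₁.1 hy₂.1 (by norm_num) (by norm_num) (by norm_num)
  have hyi : y ∈ interior (dom (conj (logNormalizer P))) :=
    (convex_dom_conj (P := P)).interior hi₁ hi₂ (by norm_num) (by norm_num) (by norm_num)
  obtain ⟨θ, hθ⟩ := exists_isSubgradient_of_mem_interior_dom_conj hs hyi
  have hR₁ := coe_toReal_conj hθ.1 (interior_subset hi₁)
  have hR₂ := coe_toReal_conj hθ.1 (interior_subset hi₂)
  have h₁ := hy₁.2 y hyT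
  have h₂ := hy₂.2 y hyT
  have l₁ := le_conj (y := y₁) hθ.1
  have l₂ := le_conj (y := y₂) hθ.1
  rw [conj_expFamily, conj_expFamily, hθ.conj_eq, ← hR₁, ← EReal.coe_add, ← EReal.coe_add,
    EReal.coe_le_coe_iff] at h₁
  rw [conj_expFamily, conj_expFamily, hθ.conj_eq, ← hR₂, ← EReal.coe_add, ← EReal.coe_add,
    EReal.coe_le_coe_iff] at h₂
  rw [← hR₁, EReal.coe_le_coe_iff] at l₁
  rw [← hR₂, EReal.coe_le_coe_iff] at l₂
  simp only [hy, inner_add_left, real_inner_smul_left] at h₁ h₂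
  -- The affine minorant from the midpoint's `θ` averages to the midpoint value, which neither
  -- minimal value exceeds. So Fenchel equality with the same `θ` holds at `y₁` and `y₂`, and both
  -- are `∇ψ_P(θ)`.
  have s₁ : IsSubgradient P y₁ θ := by
    refine isSubgradient_of_conj_le hθ.1 ?_
    rw [← hR₁, EReal.coe_le_coe_iff]
    linarith
  have s₂ : IsSubgradient P y₂ θ := by
    refine isSubgradient_of_conj_le hθ.1 ?_
    rw [← hR₂, EReal.coe_le_coe_iff]
    linarith
  rw [← s₁.grad_eq hs (hθ.mem_interior hs), ← s₂.grad_eq hs (hθ.mem_interior hs)]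

lemma mem_mlEstimators_iff {y θ : EuclideanSpace ℝ (Fin d)}
    {S : Set (EuclideanSpace ℝ (Fin d))} :
    θ ∈ mlEstimators y P S ↔ θ ∈ S ∩ naturalSpace P ∧ ∀ z ∈ S ∩ naturalSpace P,
      logZ P θ - inner ℝ y θ ≤ logZ P z - inner ℝ y z := by
  simp only [mlEstimators, argmax, density, Real.log_exp, mem_ofPred_eq]
  refine and_congr_right fun _ => forall₂_congr fun z _ => ?_
  rw [← logZ, ← logZ]
  constructor <;> intro h <;> linarith

lemma mlEstimators_nonempty [NeZero P] (hs : Steep P)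
    (hne : (interior (convexSupport Ω P)).Nonempty) {y θ : EuclideanSpace ℝ (Fin d)}
    (h : IsSubgradient P y θ) {S : Set (EuclideanSpace ℝ (Fin d))} (hS : IsClosed S)
    (hSne : (S ∩ naturalSpace P).Nonempty) : (mlEstimators y P S).Nonempty := by
  obtain ⟨θ₀, hθ₀S, hθ₀⟩ := hSne
  obtain ⟨η, hηS, hη⟩ := exists_mem_argmin (lowerSemicontinuous_tilt (P := P) y) hS hθ₀S
    ((h.isBounded_sublevel hs hne (logZ P θ₀ - inner ℝ y θ₀)).subset fun θ hθ =>
      ⟨mem_naturalSpace_of_tilt_le hθ₀ hθ,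
        (tilt_le_tilt_iff (mem_naturalSpace_of_tilt_le hθ₀ hθ) hθ₀).1 hθ⟩)
  have hmem := mem_naturalSpace_of_tilt_le hθ₀ (hη θ₀ hθ₀S)
  exact ⟨η, mem_mlEstimators_iff.2
    ⟨⟨hηS, hmem⟩, fun z hz => (tilt_le_tilt_iff hmem hz.2).1 (hη z hz.1)⟩⟩

lemma mlEstimators_eq_argmin_klDiv [NeZero P] (hs : Steep P) {y θ : EuclideanSpace ℝ (Fin d)}
    (h : IsSubgradient P y θ) (S : Set (EuclideanSpace ℝ (Fin d))) :
    mlEstimators y P S =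
      argmin (fun η => klDiv (expFamily P θ) (expFamily P η)) (S ∩ naturalSpace P) := by
  have hint := h.mem_interior hs
  have hkl : ∀ η ∈ naturalSpace P, klDiv (expFamily P θ) (expFamily P η) =
      ENNReal.ofReal (logZ P η - logZ P θ - inner ℝ y (η - θ)) := by
    intro η hη
    rw [klDiv_expFamily h.1 hη (integrable_expFamily_of_mem_interior hint),
      integral_expFamily_eq_grad hs hint, h.grad_eq hs hint]
  ext η
  rw [mem_mlEstimators_iff]
  refine and_congr_right fun hη => forall₂_congr fun z hz => ?_
  simp only
  rw [hkl η hη.2, hkl z hz.2, ENNReal.ofReal_le_ofReal_iff (by linarith [h.2 z hz.2]),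
    inner_sub_right, inner_sub_right]
  constructor <;> intro h <;> linarith

/-- Off `Θ_P` the Bregman distance is `⊤`, so minimizing over all of `S` never leaves `Θ_P` once `S`
meets it. -/
lemma mlEstimators_eq_argmin_bregman [NeZero P] (hs : Steep P) {y θ : EuclideanSpace ℝ (Fin d)}
    (h : IsSubgradient P y θ) {S : Set (EuclideanSpace ℝ (Fin d))}
    (hSne : (S ∩ naturalSpace P).Nonempty) :
    mlEstimators y P S = argmin (fun η => bregman (logNormalizer P) η θ) S := by
  have hmem : ∀ η ∈ naturalSpace P, bregman (logNormalizer P) η θ =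
      ((logZ P η - logZ P θ - inner ℝ y (η - θ) : ℝ) : EReal) := by
    intro η hη
    rw [bregman, h.grad_eq hs (h.mem_interior hs), coe_logZ hη, coe_logZ h.1]
    norm_cast
  have htop : ∀ η ∉ naturalSpace P, bregman (logNormalizer P) η θ = ⊤ := by
    intro η hη
    rw [bregman, logNormalizer_of_notMem hη, coe_logZ h.1, EReal.top_sub_coe, EReal.top_sub_coe]
  have hle : ∀ η ∈ naturalSpace P, ∀ z ∈ naturalSpace P,
      bregman (logNormalizer P) η θ ≤ bregman (logNormalizer P) z θ ↔
        logZ P η - inner ℝ y η ≤ logZ P z - inner ℝ y z := by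
    intro η hη z hz
    rw [hmem η hη, hmem z hz, EReal.coe_le_coe_iff, inner_sub_right, inner_sub_right]
    constructor <;> intro h <;> linarith
  obtain ⟨θ₀, hθ₀S, hθ₀⟩ := hSne
  ext η
  rw [mem_mlEstimators_iff]
  constructor
  · rintro ⟨hη, hmin⟩
    refine ⟨hη.1, fun z hz => ?_⟩
    by_cases hzm : z ∈ naturalSpace P
    · exact (hle η hη.2 z hzm).2 (hmin z ⟨hz, hzm⟩)
    · simp only [htop z hzm, le_top]
  · rintro ⟨hηS, hmin⟩
    have hη : η ∈ naturalSpace P := by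
      by_contra hn
      have := hmin θ₀ hθ₀S
      simp only [htop η hn, hmem θ₀ hθ₀, top_le_iff] at this
      exact EReal.coe_ne_top _ this
    exact ⟨⟨hηS, hη⟩, fun z hz => (hle η hη z hz.2).1 (hmin z hz.1)⟩

end Estimators

/-! ### Transfer of minimizers in the primal analogy -/

section PrimalAnalogy

variable {d : ℕ} {P : Measure (EuclideanSpace ℝ (Fin d))} {Ω : Set (EuclideanSpace ℝ (Fin d))}
  {S T : Set (EuclideanSpace ℝ (Fin d))}

/-- A competitor of finite divergence is interior, hence by `himg` equals `∇ψ_P*(z)` with `z ∈ T`,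
and the comparison becomes that of rate functions at `y` and `z`. -/
lemma grad_conj_mem_argmin_klDiv [NeZero P] (hs : Steep P)
    (hne : (interior (convexSupport Ω P)).Nonempty)
    (himg : grad (conj (logNormalizer P)) '' (T ∩ interior (dom (conj (logNormalizer P)))) =
      S ∩ interior (dom (logNormalizer P)))
    {y θ₀ : EuclideanSpace ℝ (Fin d)} (hθ₀ : θ₀ ∈ interior (naturalSpace P))
    (hy : y ∈ argmin (conj (logNormalizer (expFamily P θ₀))) T)
    (hyi : y ∈ interior (dom (conj (logNormalizer P)))) :
    grad (conj (logNormalizer P)) y ∈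
      argmin (fun θ => klDiv (expFamily P θ) (expFamily P θ₀)) (S ∩ naturalSpace P) := by
  have hsub := isSubgradient_grad_conj hs hne hyi
  have hmem : grad (conj (logNormalizer P)) y ∈ S ∩ interior (dom (logNormalizer P)) :=
    himg ▸ mem_image_of_mem _ ⟨hy.1, hyi⟩
  refine ⟨⟨hmem.1, hsub.1⟩, fun θ hθ => ?_⟩
  by_cases htop : klDiv (expFamily P θ) (expFamily P θ₀) = ⊤
  · simp only [htop, le_top]
  · have hθi := mem_interior_of_klDiv_ne_top hs hθ.2 hθ₀ htop
    have : θ ∈ grad (conj (logNormalizer P)) '' (T ∩ interior (dom (conj (logNormalizer P)))) := by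
      rw [himg, dom_logNormalizer]; exact ⟨hθ.1, hθi⟩
    obtain ⟨z, hz, rfl⟩ := this
    exact (klDiv_le_klDiv_iff hs hsub (isSubgradient_grad_conj hs hne hz.2)
      (interior_subset hθ₀)).2 (hy.2 z hz.1)

/-- The interior minimizer `y` makes the minimal divergence finite, so every KL minimizer is
interior and pulls back through `himg` to a minimizer in `T`. -/
lemma argmin_klDiv_subset [NeZero P] (hs : Steep P)
    (hne : (interior (convexSupport Ω P)).Nonempty)
    (himg : grad (conj (logNormalizer P)) '' (T ∩ interior (dom (conj (logNormalizer P)))) =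
      S ∩ interior (dom (logNormalizer P)))
    {y θ₀ : EuclideanSpace ℝ (Fin d)} (hθ₀ : θ₀ ∈ interior (naturalSpace P))
    (hy : y ∈ argmin (conj (logNormalizer (expFamily P θ₀))) T)
    (hyi : y ∈ interior (dom (conj (logNormalizer P)))) :
    argmin (fun θ => klDiv (expFamily P θ) (expFamily P θ₀)) (S ∩ naturalSpace P) ⊆
      grad (conj (logNormalizer P)) '' (argmin (conj (logNormalizer (expFamily P θ₀))) T ∩
        interior (dom (conj (logNormalizer P)))) := by
  intro θ hθ
  have hsub := isSubgradient_grad_conj hs hne hyi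
  have hle := hθ.2 _ (grad_conj_mem_argmin_klDiv hs hne himg hθ₀ hy hyi).1
  have hfin : klDiv (expFamily P θ) (expFamily P θ₀) ≠ ⊤ := by
    refine ne_top_of_le_ne_top ?_ hle
    simp only
    rw [klDiv_expFamily hsub.1 (interior_subset hθ₀)
      (integrable_expFamily_of_mem_interior (hsub.mem_interior hs))]
    exact ENNReal.ofReal_ne_top
  have hθi := mem_interior_of_klDiv_ne_top hs hθ.1.2 hθ₀ hfin
  have : θ ∈ grad (conj (logNormalizer P)) '' (T ∩ interior (dom (conj (logNormalizer P)))) := by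
    rw [himg, dom_logNormalizer]; exact ⟨hθ.1.1, hθi⟩
  obtain ⟨z, hz, rfl⟩ := this
  have hzy := (klDiv_le_klDiv_iff hs (isSubgradient_grad_conj hs hne hz.2) hsub
    (interior_subset hθ₀)).1 hle
  exact ⟨z, ⟨⟨hz.1, fun w hw => hzy.trans (hy.2 w hw)⟩, hz.2⟩, rfl⟩

end PrimalAnalogy

end MEM

/-! ### The theorem -/

theorem mainTheorem6 {d : ℕ} (Ω : Set (EuclideanSpace ℝ (Fin d)))
    (P : Measure (EuclideanSpace ℝ (Fin d))) [SigmaFinite P] (hdom : MEM.Dominated Ω P)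
    (hmin : MEM.Minimal Ω P) (hsteep : MEM.Steep P)
    (hsupp : ∀ θ ∈ interior (MEM.naturalSpace P), MEM.SupportCondition Ω (MEM.expFamily P θ))
    (S Sstar : Set (EuclideanSpace ℝ (Fin d))) (hS : IsClosed S) (hSstar : IsClosed Sstar)
    (hSdom : (S ∩ MEM.dom (MEM.logNormalizer P)).Nonempty)
    (hSstardom : (Sstar ∩ MEM.dom (MEM.conj (MEM.logNormalizer P))).Nonempty)
    (yhat θhat : EuclideanSpace ℝ (Fin d)) (hyhat : yhat ∈ interior (MEM.convexSupport Ω P))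
    (hθhat : θhat = MEM.grad (MEM.conj (MEM.logNormalizer P)) yhat) :
    -- the reference point is well defined
    (yhat ∈ interior (MEM.dom (MEM.conj (MEM.logNormalizer P))) ∧
      HasGradientAt (fun y => (MEM.conj (MEM.logNormalizer P) y).toReal) θhat yhat ∧
      θhat ∈ interior (MEM.dom (MEM.logNormalizer P))) ∧
    -- both estimators exist
    ((MEM.memEstimators yhat (MEM.naturalSpace P) (MEM.expFamily P) Sstar).Nonempty ∧
      (MEM.mlEstimators yhat P S).Nonempty) ∧
    -- (a) primal analogy
    ((Sstar ∩ interior (MEM.dom (MEM.conj (MEM.logNormalizer P)))).Nonempty →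
      MEM.grad (MEM.conj (MEM.logNormalizer P)) ''
          (Sstar ∩ interior (MEM.dom (MEM.conj (MEM.logNormalizer P)))) =
        S ∩ interior (MEM.dom (MEM.logNormalizer P)) →
      -- a MEM estimator in the interior of the domain is the image of a KL minimizer
      (∀ y ∈ MEM.memEstimators yhat (MEM.naturalSpace P) (MEM.expFamily P) Sstar,
        y ∈ interior (MEM.dom (MEM.conj (MEM.logNormalizer P))) →
        ∃ θ ∈ MEM.argmin (fun θ => klDiv (MEM.expFamily P θ) (MEM.expFamily P θhat))
            (S ∩ MEM.naturalSpace P),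
          θ ∈ interior (MEM.dom (MEM.logNormalizer P)) ∧
            y = MEM.grad (MEM.logNormalizer P) θ) ∧
      -- for convex `Sstar` both are unique, and they correspond to each other
      (Convex ℝ Sstar →
        ∃ yMEM θMEM : EuclideanSpace ℝ (Fin d),
          MEM.memEstimators yhat (MEM.naturalSpace P) (MEM.expFamily P) Sstar = {yMEM} ∧
          MEM.argmin (fun θ => klDiv (MEM.expFamily P θ) (MEM.expFamily P θhat))
            (S ∩ MEM.naturalSpace P) = {θMEM} ∧
          yMEM ∈ interior (MEM.dom (MEM.conj (MEM.logNormalizer P))) ∧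
          θMEM ∈ interior (MEM.dom (MEM.logNormalizer P)) ∧
          yMEM = MEM.grad (MEM.logNormalizer P) θMEM) ∧
      -- the ML estimators are the minimizers of the reversed divergence
      MEM.mlEstimators yhat P S =
        MEM.argmin (fun θ => klDiv (MEM.expFamily P θhat) (MEM.expFamily P θ))
          (S ∩ MEM.naturalSpace P)) ∧
    -- (b) dual analogy
    (MEM.memEstimators yhat (MEM.naturalSpace P) (MEM.expFamily P) Sstar =
        MEM.argmin (fun y => MEM.bregman (MEM.conj (MEM.logNormalizer P)) y yhat) Sstar ∧
      MEM.mlEstimators yhat P S =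
        MEM.argmin (fun θ => MEM.bregman (MEM.logNormalizer P) θ θhat) S) := by
  -- The zero measure has empty support, contradicting the full dimension of the convex support.
  have : NeZero P := ⟨by
    rintro rfl
    obtain ⟨y, hy⟩ := hmin.2
    simpa [MEM.convexSupport, MEM.suppIn] using interior_subset hy⟩
  have hne := hmin.2
  have hsub : MEM.IsSubgradient P yhat θhat := by
    obtain ⟨θ, hθ⟩ := MEM.exists_isSubgradient_of_mem_interior_convexSupport hsteep hyhat
    rwa [hθhat, hθ.grad_conj_eq hsteep hne]
  have hint := hsub.mem_interior hsteep
  rw [MEM.dom_logNormalizer] at hSdom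
  have hmem := MEM.memEstimators_eq hsteep hne hsub Sstar
  -- After this both sides of the dual MEM statement are the same `argmin`, so `rfl` closes it
  -- below.
  rw [hmem, MEM.bregman_conj_eq hsteep hne hsub]
  have hmemne := MEM.argmin_conj_expFamily_nonempty hint hSstar hSstardom
  refine ⟨⟨hsub.mem_interior_dom_conj hsteep hne, hsub.hasGradientAt_conj hsteep hne, ?_⟩,
    ⟨hmemne, MEM.mlEstimators_nonempty hsteep hne hsub hS hSdom⟩, ?_, rfl,
    MEM.mlEstimators_eq_argmin_bregman hsteep hsub hSdom⟩
  · rwa [MEM.dom_logNormalizer]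
  rintro ⟨y₀, hy₀, hy₀i⟩ himg
  have hpre : ∀ y ∈ MEM.argmin (MEM.conj (MEM.logNormalizer (MEM.expFamily P θhat))) Sstar,
      y ∈ interior (MEM.dom (MEM.conj (MEM.logNormalizer P))) →
      MEM.grad (MEM.conj (MEM.logNormalizer P)) y ∈ interior (MEM.dom (MEM.logNormalizer P)) ∧
        y = MEM.grad (MEM.logNormalizer P) (MEM.grad (MEM.conj (MEM.logNormalizer P)) y) := by
    intro y hy hyi
    have hs := MEM.isSubgradient_grad_conj hsteep hne hyi
    have hi := hs.mem_interior hsteep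
    refine ⟨?_, (hs.grad_eq hsteep hi).symm⟩
    rwa [MEM.dom_logNormalizer]
  refine ⟨fun y hy hyi => ⟨_, MEM.grad_conj_mem_argmin_klDiv hsteep hne himg hint hy hyi,
    hpre y hy hyi⟩, fun hconv => ?_, MEM.mlEstimators_eq_argmin_klDiv hsteep hsub S⟩
  obtain ⟨y, hy⟩ := hmemne
  have hall : ∀ z ∈ MEM.argmin (MEM.conj (MEM.logNormalizer (MEM.expFamily P θhat))) Sstar,
      z ∈ interior (MEM.dom (MEM.conj (MEM.logNormalizer P))) := fun z hz =>
    MEM.mem_interior_of_mem_argmin hsteep hne θhat hconv hy₀ hy₀i hz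
  have huniq : ∀ z ∈ MEM.argmin (MEM.conj (MEM.logNormalizer (MEM.expFamily P θhat))) Sstar,
      z = y := fun z hz => MEM.eq_of_mem_argmin hsteep hconv hz hy (hall z hz) (hall y hy)
  refine ⟨y, MEM.grad (MEM.conj (MEM.logNormalizer P)) y, ?_, ?_, hall y hy, hpre y hy (hall y hy)⟩
  · exact eq_singleton_iff_unique_mem.2 ⟨hy, huniq⟩
  · refine eq_singleton_iff_unique_mem.2
      ⟨MEM.grad_conj_mem_argmin_klDiv hsteep hne himg hint hy (hall y hy), fun θ hθ => ?_⟩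
    obtain ⟨z, hz, rfl⟩ := MEM.argmin_klDiv_subset hsteep hne himg hint hy (hall y hy) hθ
    rw [huniq z hz.1]
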